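/- Let $k$ be an algebraically closed field of characteristic $p>0$, and let $f\in k[x]$ be a polynomial of degree $s$, where $s$ is a positive integer prime to $p$. Then $y^p-y-f(x)$ is irreducible over $k(x)$. Let $L=k(x)[y]/(y^p-y-f(x))$ and let $\phi\colon Y\to\mathbb{P}^1_k$ be the cover of nonsingular projective curves over $k$ corresponding to the field extension $k(x)\hookrightarrow L$. 1. The cover $\phi$ is Galois with Galois group $G=\mathrm{Gal}(L/k(x))\cong\mathbb{Z}/p\mathbb{Z}$. There is exactly one point $P_\infty$ of $Y$ over $\infty$, and $\phi$ is ramified at $P_\infty$ and at no other point of $Y$. 2. For an integer $i\ge -1$ let $I_i=\{\sigma\in G : \nu(\sigma(z)-z)\ge i+1 \text{ for all } z\in\mathcal{O}\}$ be the $i$th (lower) ramification group at $P_\infty$, where $\nu$ is the normalized valuation and $\mathcal{O}$ the valuation ring of $L$ at $P_\infty$. Then $I_i=G\cong\mathbb{Z}/p\mathbb{Z}$ if $i\le s$, and $I_i=0$ (the trivial group) if $i>s$. 3. The genus of $Y$ is $g_Y=(p-1)(s-1)/2$. -/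

import Mathlib

open Polynomial KaehlerDifferential
open scoped WithZero

/-- A place (prime) of an extension field `F` of `k`, i.e. a closed point of the nonsingular
projective curve over `k` with function field `F`, given by its normalized discrete valuation:
a surjective valuation `F → ℤ ∪ {∞}` which is trivial on the constant field `k`.
In Mathlib's multiplicative notation, `valuation z = WithZero.exp (-n)` means `ν(z) = n`, and
`valuation z = 0` means `ν(z) = ∞`. -/
structure Place (k F : Type*) [Field k] [Field F] [Algebra k F] where
  /-- The normalized discrete valuation of the place. -/
  valuation : Valuation F ℤᵐ⁰
  surjective : Function.Surjective valuation
  trivial_on_constants : ∀ c : k, c ≠ 0 → valuation (algebraMap k F c) = 1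

namespace Place

variable {k K L : Type*} [Field k] [Field K] [Field L] [Algebra k K] [Algebra k L] [Algebra K L]

/-- The valuation ring `𝒪_Q = {z | ν_Q(z) ≥ 0}`. -/
abbrev ring (Q : Place k L) : ValuationSubring L := Q.valuation.valuationSubring

/-- The place `Q` of `L` lies over the place `P` of `K`: `𝒪_Q ∩ K = 𝒪_P`. -/
def LiesOver (Q : Place k L) (P : Place k K) : Prop :=
  Q.ring.comap (algebraMap K L) = P.ring

/-- `e` is the ramification index of `Q` over `P`: `ν_Q(x) = e ν_P(x)` for all `x` in `K`. -/
def HasRamificationIndex (Q : Place k L) (P : Place k K) (e : ℕ) : Prop :=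
  ∀ x : K, Q.valuation (algebraMap K L x) = P.valuation x ^ e

variable (K) in
/-- `Q` is unramified in `L / K`: its ramification index over the place below it is `1`. -/
def IsUnramified (Q : Place k L) : Prop :=
  ∃ P : Place k K, Q.LiesOver P ∧ Q.HasRamificationIndex P 1

variable (K) in
/-- `Q` is ramified in `L / K`: its ramification index over the place below it exceeds `1`. -/
def IsRamified (Q : Place k L) : Prop :=
  ∃ P : Place k K, Q.LiesOver P ∧ ∃ e : ℕ, 1 < e ∧ Q.HasRamificationIndex P e

variable (K) in
/-- The `i`th ramification group (lower numbering, `i ≥ -1`) of `Q` in `L / K`: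
all `σ` in the Galois group with `ν_Q(σ(z) - z) ≥ i + 1` for every `z ∈ 𝒪_Q`. -/
def ramificationGroup (Q : Place k L) (i : ℤ) : Set (L ≃ₐ[K] L) :=
  {σ | ∀ z ∈ Q.ring, Q.valuation (σ z - z) ≤ WithZero.exp (-(i + 1))}

/-- The differential `ω` is regular at `Q`: it lies in the `𝒪_Q`-submodule of `Ω_{L/k}`
generated by the `dt` with `t ∈ 𝒪_Q`. -/
def IsRegularAt (Q : Place k L) (ω : Ω[L⁄k]) : Prop :=
  ω ∈ Submodule.span Q.ring (Set.range fun t : Q.ring => KaehlerDifferential.D k L (t : L))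

lemma algebraMap_mem_ring (Q : Place k L) (c : k) : algebraMap k L c ∈ Q.ring := by
  by_cases hc : c = 0
  · simp [hc]
  · exact (Q.trivial_on_constants c hc).le

/-- The place at infinity of the rational function field: `ν_∞(g / h) = deg h - deg g`. -/
noncomputable def infinity (k : Type*) [Field k] : Place k (RatFunc k) := by
  classical
  exact
  { valuation := RatFunc.inftyValuation k
    surjective := by
      intro z
      induction z using WithZero.expRecOn with
      | zero => exact ⟨0, map_zero _⟩
      | exp n => exact ⟨RatFunc.X ^ n, RatFunc.inftyValuation.X_zpow k n⟩
    trivial_on_constants := fun c hc => by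
      simpa using RatFunc.inftyValuation.C k hc }

end Place

section Genus

variable (k F : Type*) [Field k] [Field F] [Algebra k F]

/-- The `k`-space `H⁰(Y, Ω)` of differentials regular at every point of the nonsingular projective
curve `Y` with function field `F`. -/
def regularDifferentials : Submodule k Ω[F⁄k] where
  carrier := {ω | ∀ Q : Place k F, Q.IsRegularAt ω}
  add_mem' ha hb Q := Submodule.add_mem _ (ha Q) (hb Q)
  zero_mem' Q := Submodule.zero_mem _
  smul_mem' c ω hω Q := by
    have h := Submodule.smul_mem _ (⟨algebraMap k F c, Q.algebraMap_mem_ring c⟩ : Q.ring) (hω Q)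
    have e : (⟨algebraMap k F c, Q.algebraMap_mem_ring c⟩ : Q.ring) • ω = c • ω :=
      algebraMap_smul F c ω
    rw [e] at h
    exact h

/-- The genus `dim_k H⁰(Y, Ω)`, as a cardinal, of the nonsingular projective curve `Y` with function
field `F` over the algebraically closed field `k`. -/
noncomputable def curveGenus : Cardinal := Module.rank k (regularDifferentials k F)

end Genus

/-- The polynomial `y ^ p - y - f(x)` in the variable `y` over `k(x)`. -/
noncomputable def artinSchreierPoly {k : Type*} [Field k] (p : ℕ) (f : k[X]) : (RatFunc k)[X] :=
  X ^ p - X - C (algebraMap k[X] (RatFunc k) f)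

/-- The `k(x)`-algebra `k(x)[y] / (y ^ p - y - f(x))`. -/
abbrev ArtinSchreierExt {k : Type*} [Field k] (p : ℕ) (f : k[X]) : Type _ :=
  AdjoinRoot (artinSchreierPoly p f)

-- Write `K = k(x)` and let `y` be the adjoined root. Two roots of `y ^ p - y = a` differ by an
-- element of the prime field. Hence the polynomial is irreducible as soon as it has no root in `K`
-- (a root would have degree `s / p`), and every automorphism of `L` over `K` has the form `y ↦ y +
-- n`.
--
-- At a place where `x` has a pole, comparing pole orders in `y ^ p - y = f(x)` shows that `x` has a
-- pole of order `p` and `y` one of order `s`. As `p` does not divide `s`, the nonzero terms `r_j y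
-- ^ j` with `j < p` have orders distinct modulo `p`, so nothing cancels in their sum
-- (`exists_valuation_sum_eq`). This determines the valuation, whence uniqueness and total
-- ramification. It also reduces the ramification groups to single terms: replacing `y ^ j` by `(y +
-- n) ^ j - y ^ j` gains at least `s` in order, and exactly `s` for a uniformizer `x ^ a y ^ b`.
--
-- At the other places, the `y`-derivative of the equation is `-1`, so `x - a` is a local parameter
-- (`exists_isLocalModel`) and nothing ramifies.
--
-- For the genus, write `ω = h dx`. Regularity at affine points makes `h` integral over `k[x]`,
-- hence a polynomial in `x` and `y` since the discriminant is `±1`. At infinity `dx` has order `ps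
-- - s - p - 1`, and the absence of cancellation turns regularity into a bound on each monomial of
-- `h` (`mem_regularDifferentials_iff`). The allowed monomials correspond to the interior lattice
-- points of a triangle, half of those in a rectangle.

universe u

/-! ### Artin-Schreier extensions of a field of characteristic `p`. -/

section ArtinSchreier

lemma monic_X_pow_sub_X_sub_C {R : Type*} [CommRing R] [Nontrivial R] (p : ℕ) [Fact p.Prime]
    (a : R) : (X ^ p - X - C a : R[X]).Monic := by
  have hp : 1 < p := (Fact.out : p.Prime).one_lt
  have h : (X ^ p - X - C a : R[X]) = X ^ p - (X + C a) := by ring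
  rw [h]
  refine monic_X_pow_sub ?_
  rw [degree_X_add_C]
  exact_mod_cast hp

lemma natDegree_X_pow_sub_X_sub_C {R : Type*} [CommRing R] [Nontrivial R] (p : ℕ) [Fact p.Prime]
    (a : R) : (X ^ p - X - C a : R[X]).natDegree = p := by
  have hp : 1 < p := (Fact.out : p.Prime).one_lt
  have h : (X ^ p - X - C a : R[X]) = X ^ p - (X + C a) := by ring
  rw [h, natDegree_sub_eq_left_of_natDegree_lt] <;> simp [hp]

variable {K : Type*} [Field K] (p : ℕ) [Fact p.Prime]

variable [CharP K p]

/-- Frobenius is additive, so it fixes the difference of two roots. -/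
lemma sub_mem_bot_of_pow_sub_eq {a b c : K} (ha : a ^ p - a = c) (hb : b ^ p - b = c) :
    a - b ∈ (⊥ : Subfield K) := by
  rw [Subfield.mem_bot_iff_pow_eq_self K p, sub_pow_char]
  linear_combination ha - hb

/-- An Artin-Schreier polynomial without a root in the ground field is irreducible. -/
theorem irreducible_X_pow_sub_X_sub_C (a : K) (h : ∀ b : K, b ^ p - b ≠ a) :
    Irreducible (X ^ p - X - C a : K[X]) := by
  have hp : p.Prime := Fact.out
  have hm := monic_X_pow_sub_X_sub_C p a
  have hd := natDegree_X_pow_sub_X_sub_C p a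
  rw [hm.irreducible_iff_lt_natDegree_lt (fun h1 => by
    rw [h1, natDegree_one] at hd; exact hp.ne_zero hd.symm)]
  intro q hq hqd hdvd
  rw [hd, Finset.mem_Ioc] at hqd
  let E := AlgebraicClosure K
  have : CharP E p := charP_of_injective_algebraMap (algebraMap K E).injective p
  let φ := algebraMap K E
  have hroot : ∀ β ∈ (q.map φ).roots, β ^ p - β = φ a := by
    intro β hβ
    have h1 : (q.map φ).IsRoot β := isRoot_of_mem_roots hβ
    have h2 := h1.dvd (Polynomial.map_dvd φ hdvd)
    simp only [IsRoot, Polynomial.map_sub, Polynomial.map_pow, map_X, map_C, eval_sub, eval_pow,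
      eval_X, eval_C] at h2
    linear_combination h2
  have hsplit : (q.map φ).Splits := IsAlgClosed.splits _
  have hcard : (q.map φ).roots.card = q.natDegree := by
    rw [← hsplit.natDegree_eq_card_roots, natDegree_map]
  obtain ⟨α, hα⟩ : ∃ α, α ∈ (q.map φ).roots := by
    apply Multiset.card_pos_iff_exists_mem.mp; omega
  have hbot : ∀ z ∈ (⊥ : Subfield E), z ∈ φ.fieldRange := fun z hz => (bot_le (a := φ.fieldRange)) hz
  -- The roots of the factor `q` sum to minus a coefficient, and each is `α` plus an element of the
  -- prime field. So `deg q • α` lies in the ground field, and `0 < deg q < p` makes `deg q`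
  -- invertible.
  have hsum : (q.map φ).roots.sum ∈ φ.fieldRange := by
    have := hsplit.nextCoeff_eq_neg_sum_roots_of_monic (hq.map φ)
    rw [← neg_eq_iff_eq_neg] at this
    rw [← this, nextCoeff_map φ.injective]
    exact neg_mem ⟨_, rfl⟩
  have hdiff : ((q.map φ).roots.map (fun β => β - α)).sum ∈ φ.fieldRange := by
    apply multiset_sum_mem
    intro z hz
    obtain ⟨β, hβ, rfl⟩ := Multiset.mem_map.mp hz
    exact hbot _ (sub_mem_bot_of_pow_sub_eq p (hroot β hβ) (hroot α hα))
  rw [Multiset.sum_map_sub, Multiset.map_id', Multiset.map_const', Multiset.sum_replicate,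
    hcard] at hdiff
  have hmul : (q.natDegree : E) * α ∈ φ.fieldRange := by
    have := sub_mem hsum hdiff
    simpa using this
  have hne : (q.natDegree : E) ≠ 0 := by
    rw [Ne, CharP.cast_eq_zero_iff E p]
    intro hdv
    have := Nat.le_of_dvd hqd.1 hdv
    have := hp.two_le
    omega
  have hmem : α ∈ φ.fieldRange := by
    have := mul_mem (inv_mem (natCast_mem φ.fieldRange q.natDegree)) hmul
    rwa [inv_mul_cancel_left₀ hne] at this
  obtain ⟨b, rfl⟩ := hmem
  apply h b
  apply φ.injective
  simpa using hroot _ hα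

variable {L : Type*} [Field L] [Algebra K L] {p}

/-- A power basis of Artin-Schreier type. -/
structure IsArtinSchreier (p : ℕ) (a : K) (B : PowerBasis K L) : Prop where
  dim : B.dim = p
  gen : B.gen ^ p - B.gen = algebraMap K L a

namespace IsArtinSchreier

variable {a : K} {B : PowerBasis K L} (hB : IsArtinSchreier p a B)
include hB

omit [Fact p.Prime] [CharP K p] in
lemma exists_repr (w : L) :
    ∃ r : ℕ → K, w = ∑ j ∈ Finset.range p, algebraMap K L (r j) * B.gen ^ j := by
  obtain ⟨g, hg, rfl⟩ := B.exists_eq_aeval w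
  refine ⟨g.coeff, ?_⟩
  rw [aeval_eq_sum_range' (n := p) (by rw [← hB.dim]; exact hg)]
  simp [Algebra.smul_def]

omit [CharP K p] in
lemma minpoly_eq : minpoly K B.gen = X ^ p - X - C a := by
  symm
  refine (eq_of_monic_of_dvd_of_natDegree_le (minpoly.monic B.isIntegral_gen)
    (monic_X_pow_sub_X_sub_C p a) (minpoly.dvd K B.gen (by simp [hB.gen])) ?_)
  rw [natDegree_X_pow_sub_X_sub_C, B.natDegree_minpoly, hB.dim]

/-- This constant derivative gives both separability and the unit discriminant. -/
lemma derivative_minpoly : derivative (minpoly K B.gen) = -1 := by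
  rw [hB.minpoly_eq, derivative_sub, derivative_sub, derivative_X_pow, CharP.cast_eq_zero]
  simp

lemma separable : (X ^ p - X - C a : K[X]).Separable := by
  have h := hB.derivative_minpoly
  rw [hB.minpoly_eq] at h
  rw [Polynomial.Separable, h]
  exact isCoprime_one_right.neg_right

theorem isGalois : IsGalois K L := by
  have : CharP L p := charP_of_injective_algebraMap (algebraMap K L).injective p
  have hp : p.Prime := Fact.out
  have : FiniteDimensional K L := B.finite
  -- The `p` elements `y + i` are distinct roots, so the polynomial already splits in `L`.
  have hroot : ∀ i ∈ Finset.range p,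
      B.gen + (i : L) ∈ ((X ^ p - X - C a : K[X]).map (algebraMap K L)).roots := by
    intro i _
    rw [mem_roots ((monic_X_pow_sub_X_sub_C p a).map _).ne_zero, IsRoot, eval_map_algebraMap]
    have h1 : (i : L) ^ p = i := by
      rw [← map_natCast (ZMod.castHom dvd_rfl L) i, ← map_pow, ZMod.pow_card]
    simp only [map_sub, map_pow, aeval_X, aeval_C]
    rw [add_pow_char, h1]
    linear_combination hB.gen
  have hinj : Set.InjOn (fun i : ℕ => B.gen + (i : L)) (Finset.range p) := by
    intro i hi j hj hij
    simp only [add_right_inj] at hij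
    rw [CharP.natCast_eq_natCast L p] at hij
    simp only [Finset.coe_range, Set.mem_Iio] at hi hj
    exact Nat.ModEq.eq_of_lt_of_lt hij hi hj
  have hsplit : ((X ^ p - X - C a : K[X]).map (algebraMap K L)).Splits := by
    rw [splits_iff_card_roots]
    refine le_antisymm (card_roots' _) ?_
    rw [natDegree_map, natDegree_X_pow_sub_X_sub_C]
    classical
    calc p = ((Finset.range p).image fun i : ℕ => B.gen + (i : L)).card := by
          rw [Finset.card_image_of_injOn hinj, Finset.card_range]
      _ ≤ _ := by
          refine le_trans (Finset.card_le_card ?_) (Multiset.toFinset_card_le _)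
          intro z hz
          obtain ⟨i, hi, rfl⟩ := Finset.mem_image.mp hz
          exact Multiset.mem_toFinset.mpr (hroot i hi)
  have : IsSplittingField K L (X ^ p - X - C a) := by
    refine ⟨hsplit, ?_⟩
    rw [eq_top_iff, ← B.adjoin_gen_eq_top]
    apply Algebra.adjoin_mono
    rw [Set.singleton_subset_iff, mem_rootSet]
    exact ⟨(monic_X_pow_sub_X_sub_C p a).ne_zero, by simp [hB.gen]⟩
  exact IsGalois.of_separable_splitting_field hB.separable

theorem nonempty_mulEquiv : Nonempty ((L ≃ₐ[K] L) ≃* Multiplicative (ZMod p)) := by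
  have := hB.isGalois
  have : FiniteDimensional K L := B.finite
  have h := IsGalois.card_aut_eq_finrank K L
  rw [B.finrank, hB.dim] at h
  exact ⟨mulEquivOfPrimeCardEq (p := p) h (by simp)⟩

lemma exists_aut_apply_gen (σ : L ≃ₐ[K] L) : ∃ n : ℤ, σ B.gen = B.gen + n := by
  have : CharP L p := charP_of_injective_algebraMap (algebraMap K L).injective p
  have h : (σ B.gen) ^ p - σ B.gen = algebraMap K L a := by
    rw [← map_pow, ← map_sub, hB.gen, AlgEquiv.commutes]
  obtain ⟨n, hn⟩ := (mem_bot_iff_intCast p L).mp (sub_mem_bot_of_pow_sub_eq p h hB.gen)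
  exact ⟨n, by rw [hn]; ring⟩

/-- The discriminant of a power basis is, up to sign, the norm of the derivative of the minimal
polynomial at the generator, here the norm of `-1`. -/
lemma isUnit_discr : Algebra.discr K B.basis = 1 ∨ Algebra.discr K B.basis = -1 := by
  have := hB.isGalois
  have : FiniteDimensional K L := B.finite
  rw [Algebra.discr_powerBasis_eq_norm, hB.derivative_minpoly, map_neg, map_one,
    ← map_one (algebraMap K L), ← map_neg, Algebra.norm_algebraMap]
  rcases neg_one_pow_eq_or K (Module.finrank K L * (Module.finrank K L - 1) / 2) with h | h <;>
  rcases neg_one_pow_eq_or K (Module.finrank K L) with h' | h' <;>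
  rw [h, h'] <;> simp

/-- The ring of integers of an Artin-Schreier extension is generated by the Artin-Schreier root. -/
theorem exists_repr_of_isIntegral {R : Type*} [CommRing R] [IsIntegrallyClosed R]
    [Algebra R K] [Algebra R L] [IsScalarTower R K L] [IsFractionRing R K] {b : R}
    (hb : algebraMap R K b = a) {z : L} (hz : IsIntegral R z) :
    ∃ r : ℕ → R, z = ∑ j ∈ Finset.range p, algebraMap R L (r j) * B.gen ^ j := by
  have := hB.isGalois
  have : FiniteDimensional K L := B.finite
  have : IsDomain R := (IsFractionRing.injective R K).isDomain
  have hmon := monic_X_pow_sub_X_sub_C p b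
  have hnat := natDegree_X_pow_sub_X_sub_C p b
  have hev : aeval B.gen (X ^ p - X - C b : R[X]) = 0 := by
    simp [hB.gen, ← hb, ← IsScalarTower.algebraMap_apply]
  have hint : IsIntegral R B.gen := ⟨_, hmon, by rwa [← aeval_def]⟩
  -- The discriminant times an integral element always lies in `R[y]`; here it is `±1`. Reduction
  -- modulo the monic equation then leaves powers of `y` below `p`.
  have hmem : z ∈ Algebra.adjoin R {B.gen} := by
    have h := Algebra.discr_mul_isIntegral_mem_adjoin (R := R) K hint hz
    rcases hB.isUnit_discr with h1 | h1 <;> rw [h1] at h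
    · simpa using h
    · simpa using neg_mem h
  rw [Algebra.adjoin_singleton_eq_range_aeval] at hmem
  obtain ⟨g, rfl⟩ := hmem
  refine ⟨(g %ₘ (X ^ p - X - C b)).coeff, ?_⟩
  have hlt : (g %ₘ (X ^ p - X - C b)).natDegree < p := by
    have := natDegree_modByMonic_lt g hmon (fun h => by rw [h, natDegree_one] at hnat; exact (Fact.out : p.Prime).ne_zero hnat.symm)
    rwa [hnat] at this
  have h2 : aeval B.gen g = aeval B.gen (g %ₘ (X ^ p - X - C b)) := by
    conv_lhs => rw [← modByMonic_add_div g (X ^ p - X - C b)]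
    rw [map_add, map_mul, hev, zero_mul, add_zero]
  change aeval B.gen g = _
  rw [h2, aeval_eq_sum_range' hlt]
  simp [Algebra.smul_def]

end IsArtinSchreier
end ArtinSchreier

/-! ### Generalities on valuations. -/

lemma WithZero.exp_pow_eq (a : ℤ) (n : ℕ) : (WithZero.exp a) ^ n = WithZero.exp (n * a) := by
  rw [← WithZero.exp_nsmul, nsmul_eq_mul]

lemma WithZero.exp_zpow_eq (a n : ℤ) : (WithZero.exp a) ^ n = WithZero.exp (n * a) := by
  rw [← WithZero.exp_zsmul, smul_eq_mul]

/-- A sum of elements of pairwise distinct valuations has the valuation of its largest term. -/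
lemma Valuation.exists_map_sum_eq {R Γ ι : Type*} [Ring R] [LinearOrderedCommGroupWithZero Γ]
    (v : Valuation R Γ) {s : Finset ι} (hs : s.Nonempty) (g : ι → R)
    (h : ∀ i ∈ s, ∀ j ∈ s, v (g i) ≠ 0 → v (g i) = v (g j) → i = j) :
    ∃ j ∈ s, v (∑ i ∈ s, g i) = v (g j) ∧ ∀ i ∈ s, v (g i) ≤ v (g j) := by
  classical
  obtain ⟨j, hj, hmax⟩ := Finset.exists_max_image s (fun i => v (g i)) hs
  refine ⟨j, hj, ?_, hmax⟩
  by_cases h0 : v (g j) = 0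
  · rw [h0]
    refine le_antisymm (v.map_sum_le fun i hi => ?_) (zero_le)
    exact h0 ▸ hmax i hi
  · refine v.map_sum_eq_of_lt hj fun i hi => ?_
    rw [Finset.mem_sdiff, Finset.mem_singleton] at hi
    refine lt_of_le_of_ne (hmax i hi.1) fun he => hi.2 (h i hi.1 j hj (he ▸ h0) he)

/-- If `y ^ p - y` has a pole then its order is `p` times the order of the pole of `y`. -/
lemma Valuation.map_pow_sub_self_of_one_lt {R Γ : Type*} [CommRing R]
    [LinearOrderedCommGroupWithZero Γ] (v : Valuation R Γ) {p : ℕ} (hp : 1 < p) {y : R}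
    (h : 1 < v (y ^ p - y)) : v (y ^ p - y) = v y ^ p := by
  have hy : 1 < v y := by
    by_contra! hle
    refine absurd (v.map_sub_le (g := 1) ?_ hle) h.not_ge
    rw [map_pow]
    exact pow_le_one' hle p
  rw [v.map_sub_eq_of_lt_left, map_pow]
  rw [map_pow]
  exact lt_self_pow₀ hy hp

/-! ### Points over infinity: pole orders, total ramification, uniqueness. -/

namespace Place

variable {k L : Type*} [Field k] [Field L] [Algebra k L]

instance (Q : Place k L) : Q.valuation.IsTrivialOn k := ⟨fun c hc => Q.trivial_on_constants c hc⟩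

lemma ext_valuation {Q Q' : Place k L} (h : ∀ w, Q.valuation w = Q'.valuation w) : Q = Q' := by
  cases Q
  cases Q'
  congr
  exact Valuation.ext h

lemma valuation_le_one_algebraMap (Q : Place k L) (c : k) :
    Q.valuation (algebraMap k L c) ≤ 1 :=
  Q.algebraMap_mem_ring c

lemma valuation_intCast_le_one (Q : Place k L) (n : ℤ) : Q.valuation (n : L) ≤ 1 := by
  have := Q.valuation_le_one_algebraMap (n : k)
  rwa [map_intCast] at this

lemma valuation_intCast_of_ne_zero (Q : Place k L) {n : ℤ} (hn : (n : L) ≠ 0) :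
    Q.valuation (n : L) = 1 := by
  have := Q.trivial_on_constants (n : k) (fun h => hn (by
    rw [← map_intCast (algebraMap k L), h, map_zero]))
  rwa [map_intCast] at this

lemma infinity_valuation_of_ne_zero {r : RatFunc k} (hr : r ≠ 0) :
    (infinity k).valuation r = WithZero.exp r.intDegree := by
  classical
  exact RatFunc.inftyValuation_of_nonzero k hr

variable [Algebra (RatFunc k) L]

variable (k L) in
/-- The coordinate function `x` of the projective line, in an extension of `k(x)`. -/
noncomputable abbrev coord : L := algebraMap (RatFunc k) L RatFunc.X

variable [IsScalarTower k (RatFunc k) L]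

lemma algebraMap_polynomial (q : k[X]) :
    algebraMap (RatFunc k) L (algebraMap k[X] (RatFunc k) q) = aeval (coord k L) q := by
  rw [coord, aeval_algebraMap_apply]
  congr 1
  rw [← RatFunc.algebraMap_X, aeval_algebraMap_apply, aeval_X_left_apply]

section Infinity

variable {Q : Place k L} (hx : 1 < Q.valuation (coord k L))
include hx

omit [IsScalarTower k (RatFunc k) L] in
lemma valuation_aeval_of_one_lt {q : k[X]} (hq : q ≠ 0) :
    Q.valuation (aeval (coord k L) q) = Q.valuation (coord k L) ^ q.natDegree :=
  valuation_aeval_eq_valuation_X_pow_natDegree_of_one_lt_valuation_X _ hx hq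

lemma valuation_algebraMap_of_one_lt {r : RatFunc k} (hr : r ≠ 0) :
    Q.valuation (algebraMap (RatFunc k) L r) = Q.valuation (coord k L) ^ r.intDegree := by
  induction r using RatFunc.induction_on with
  | f a b hb =>
    have ha : a ≠ 0 := by rintro rfl; simp at hr
    rw [RatFunc.intDegree_div (by simpa using ha) (by simpa using hb), map_div₀, map_div₀,
      zpow_sub₀ (ne_zero_of_lt hx)]
    simp_rw [RatFunc.intDegree_polynomial, zpow_natCast, algebraMap_polynomial]
    rw [valuation_aeval_of_one_lt hx ha, valuation_aeval_of_one_lt hx hb]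

variable {p : ℕ} [Fact p.Prime] {f : k[X]} {B : PowerBasis (RatFunc k) L}
  (hB : IsArtinSchreier p (algebraMap k[X] (RatFunc k) f) B)
  (hf : 0 < f.natDegree) (hfp : Nat.Coprime f.natDegree p)
include hB hf hfp

/-- The equation gives `p · ord y = s · ord x`, and coprimality extracts the common factor `m`,
later shown to be `1`. -/
lemma exists_valuation_eq_exp_mul : ∃ m : ℤ, 0 < m ∧
    Q.valuation (coord k L) = WithZero.exp (p * m) ∧
    Q.valuation B.gen = WithZero.exp (f.natDegree * m) := by
  have hp : p.Prime := Fact.out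
  have hf0 : f ≠ 0 := by rintro rfl; simp at hf
  have h1 : Q.valuation (B.gen ^ p - B.gen) = Q.valuation (coord k L) ^ f.natDegree := by
    rw [hB.gen, algebraMap_polynomial, valuation_aeval_of_one_lt hx hf0]
  have h2 := Q.valuation.map_pow_sub_self_of_one_lt hp.one_lt (y := B.gen)
    (by rw [h1]; exact one_lt_pow₀ hx hf.ne')
  rw [h1] at h2
  have hx0 : Q.valuation (coord k L) ≠ 0 := ne_zero_of_lt hx
  have hy0 : Q.valuation B.gen ≠ 0 := by
    intro h
    rw [h, zero_pow hp.ne_zero] at h2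
    exact pow_ne_zero _ hx0 h2
  obtain ⟨a, ha⟩ : ∃ a, Q.valuation (coord k L) = WithZero.exp a := ⟨_, (WithZero.exp_log hx0).symm⟩
  obtain ⟨b, hb⟩ : ∃ b, Q.valuation B.gen = WithZero.exp b := ⟨_, (WithZero.exp_log hy0).symm⟩
  rw [ha, hb, WithZero.exp_pow_eq, WithZero.exp_pow_eq, WithZero.exp_inj] at h2
  have hdvd : (p : ℤ) ∣ a := by
    refine IsCoprime.dvd_of_dvd_mul_left (Nat.isCoprime_iff_coprime.mpr hfp.symm) ⟨b, h2⟩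
  obtain ⟨m, rfl⟩ := hdvd
  have hp0 : (0 : ℤ) < p := by exact_mod_cast hp.pos
  refine ⟨m, ?_, ha, ?_⟩
  · rw [ha, ← WithZero.exp_zero, WithZero.exp_lt_exp] at hx
    exact pos_of_mul_pos_right hx hp0.le
  · rw [hb, WithZero.exp_inj]
    apply mul_left_cancel₀ hp0.ne'
    linear_combination -h2

/-- The exponent of the `j`th term is `m` times a number congruent to `s * j` modulo `p`, and `s` is
invertible modulo `p`. So distinct nonzero terms have distinct valuations and the largest one wins.
-/
lemma exists_valuation_sum_eq (r : ℕ → RatFunc k) : ∃ j ∈ Finset.range p,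
    Q.valuation (∑ j ∈ Finset.range p, algebraMap (RatFunc k) L (r j) * B.gen ^ j) =
      Q.valuation (algebraMap (RatFunc k) L (r j) * B.gen ^ j) ∧
    ∀ i ∈ Finset.range p, Q.valuation (algebraMap (RatFunc k) L (r i) * B.gen ^ i) ≤
      Q.valuation (algebraMap (RatFunc k) L (r j) * B.gen ^ j) := by
  have hp : p.Prime := Fact.out
  obtain ⟨m, hm, hxm, hym⟩ := exists_valuation_eq_exp_mul hx hB hf hfp
  refine Q.valuation.exists_map_sum_eq ⟨0, by simpa using hp.pos⟩ _ ?_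
  have hval : ∀ j, r j ≠ 0 → Q.valuation (algebraMap (RatFunc k) L (r j) * B.gen ^ j) =
      WithZero.exp (m * (p * (r j).intDegree + f.natDegree * j)) := by
    intro j hj
    rw [map_mul, map_pow, valuation_algebraMap_of_one_lt hx hj, hxm, hym, WithZero.exp_pow_eq,
      WithZero.exp_zpow_eq, ← WithZero.exp_add]
    congr 1
    ring
  intro i hi j hj h0 hij
  have hri : r i ≠ 0 := by intro h; simp [h] at h0
  have hrj : r j ≠ 0 := by intro h; simp [h] at hij; simp [hij] at h0
  rw [hval i hri, hval j hrj, WithZero.exp_inj] at hij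
  have h3 := mul_left_cancel₀ hm.ne' hij
  have h4 : (p : ℤ) ∣ f.natDegree * ((i : ℤ) - j) :=
    ⟨(r j).intDegree - (r i).intDegree, by linear_combination h3⟩
  have h5 : (p : ℤ) ∣ (i : ℤ) - j :=
    IsCoprime.dvd_of_dvd_mul_left (Nat.isCoprime_iff_coprime.mpr hfp.symm) h4
  rw [Finset.mem_range] at hi hj
  exact (Nat.ModEq.eq_of_lt_of_lt ((Nat.modEq_iff_dvd.mpr h5)) hj hi).symm

/-- At a point over infinity, `x` has a pole of order `p` and `y` has a pole of order `deg f`. -/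
theorem valuation_coord_and_gen : Q.valuation (coord k L) = WithZero.exp (p : ℤ) ∧
    Q.valuation B.gen = WithZero.exp (f.natDegree : ℤ) := by
  obtain ⟨m, hm, hxm, hym⟩ := exists_valuation_eq_exp_mul hx hB hf hfp
  suffices m = 1 by subst this; rw [mul_one] at hxm hym; exact ⟨hxm, hym⟩
  -- By absence of cancellation every exponent is a multiple of `m`, while a normalized valuation
  -- attains the exponent `1`.
  obtain ⟨w, hw⟩ := Q.surjective (WithZero.exp 1)
  obtain ⟨r, rfl⟩ := hB.exists_repr w
  obtain ⟨j, -, hj, -⟩ := exists_valuation_sum_eq hx hB hf hfp r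
  rw [hj] at hw
  have hr : r j ≠ 0 := by
    intro h
    rw [h, map_zero, zero_mul, map_zero] at hw
    exact WithZero.exp_ne_zero hw.symm
  rw [map_mul, map_pow, valuation_algebraMap_of_one_lt hx hr, hxm, hym, WithZero.exp_pow_eq,
      WithZero.exp_zpow_eq, ← WithZero.exp_add, WithZero.exp_inj] at hw
  have : m ∣ 1 := ⟨(r j).intDegree * p + j * f.natDegree, by linear_combination -hw⟩
  exact Int.eq_one_of_dvd_one hm.le this

lemma valuation_algebraMap_eq_exp {r : RatFunc k} (hr : r ≠ 0) :
    Q.valuation (algebraMap (RatFunc k) L r) = WithZero.exp (p * r.intDegree) := by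
  rw [valuation_algebraMap_of_one_lt hx hr, (valuation_coord_and_gen hx hB hf hfp).1,
    WithZero.exp_zpow_eq, mul_comm]

lemma valuation_term_eq_exp {r : RatFunc k} (hr : r ≠ 0) (j : ℕ) :
    Q.valuation (algebraMap (RatFunc k) L r * B.gen ^ j) =
      WithZero.exp (p * r.intDegree + f.natDegree * j) := by
  rw [map_mul, map_pow, valuation_algebraMap_eq_exp hx hB hf hfp hr,
    (valuation_coord_and_gen hx hB hf hfp).2, WithZero.exp_pow_eq, ← WithZero.exp_add, mul_comm (j : ℤ)]

lemma valuation_term_le_sum (r : ℕ → RatFunc k) {i : ℕ} (hi : i ∈ Finset.range p) :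
    Q.valuation (algebraMap (RatFunc k) L (r i) * B.gen ^ i) ≤
    Q.valuation (∑ j ∈ Finset.range p, algebraMap (RatFunc k) L (r j) * B.gen ^ j) := by
  obtain ⟨j, -, h, hle⟩ := exists_valuation_sum_eq hx hB hf hfp r
  rw [h]
  exact hle i hi

lemma liesOver_infinity : Q.LiesOver (infinity k) := by
  ext r
  change Q.valuation _ ≤ 1 ↔ (infinity k).valuation r ≤ 1
  by_cases hr : r = 0
  · simp [hr]
  have hp : (0 : ℤ) < p := by exact_mod_cast (Fact.out : p.Prime).pos
  rw [valuation_algebraMap_eq_exp hx hB hf hfp hr, infinity_valuation_of_ne_zero hr,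
    ← WithZero.exp_zero, WithZero.exp_le_exp, WithZero.exp_le_exp]
  exact ⟨fun h => by by_contra! h'; nlinarith, fun h => by nlinarith⟩

/-- A point over infinity is totally ramified. -/
lemma hasRamificationIndex_infinity : Q.HasRamificationIndex (infinity k) p := by
  intro r
  change _ = (infinity k).valuation r ^ p
  by_cases hr : r = 0
  · simp [hr, (Fact.out : p.Prime).ne_zero]
  rw [valuation_algebraMap_eq_exp hx hB hf hfp hr, infinity_valuation_of_ne_zero hr,
    WithZero.exp_pow_eq]

theorem isRamified_of_one_lt : Q.IsRamified (RatFunc k) :=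
  ⟨infinity k, liesOver_infinity hx hB hf hfp, p, (Fact.out : p.Prime).one_lt,
    hasRamificationIndex_infinity hx hB hf hfp⟩

/-- There is at most one point over infinity. -/
theorem eq_of_one_lt {Q' : Place k L} (hx' : 1 < Q'.valuation (coord k L)) : Q' = Q := by
  -- The valuation of each term is the same at both places, and each sum has the valuation of its
  -- largest term.
  have key : ∀ {P P' : Place k L}, 1 < P.valuation (coord k L) → 1 < P'.valuation (coord k L) →
      ∀ w, P.valuation w ≤ P'.valuation w := by
    intro P P' h h' w
    obtain ⟨r, rfl⟩ := hB.exists_repr w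
    obtain ⟨j, hj, hv, -⟩ := exists_valuation_sum_eq h hB hf hfp r
    rw [hv]
    refine le_trans (le_of_eq ?_) (valuation_term_le_sum h' hB hf hfp r hj)
    by_cases hr : r j = 0
    · simp [hr]
    rw [valuation_term_eq_exp h hB hf hfp hr, valuation_term_eq_exp h' hB hf hfp hr]
  exact ext_valuation fun w => le_antisymm (key hx' hx w) (key hx hx' w)

end Infinity

omit [IsScalarTower k (RatFunc k) L] in
lemma one_lt_of_liesOver_infinity {Q : Place k L} (h : Q.LiesOver (infinity k)) :
    1 < Q.valuation (coord k L) := by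
  by_contra! hle
  have h1 : RatFunc.X ∈ Q.ring.comap (algebraMap (RatFunc k) L) := hle
  rw [h] at h1
  change (infinity k).valuation RatFunc.X ≤ 1 at h1
  rw [infinity_valuation_of_ne_zero RatFunc.X_ne_zero, RatFunc.intDegree_X, ← WithZero.exp_zero, WithZero.exp_le_exp] at h1
  omega

end Place

/-! ### Ramification groups at infinity. -/

/-- These exponents make `x ^ a * y ^ b` a uniformizer at infinity with `b` prime to `p`; `b` is the
residue of `-1 / s` modulo `p`. -/
lemma Nat.Coprime.exists_mul_add_mul_eq_neg_one {p s : ℕ} [Fact p.Prime] (h : Nat.Coprime s p) :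
    ∃ (a : ℤ) (b : ℕ), 0 < b ∧ b < p ∧ a * p + b * s = -1 := by
  have hs : (s : ZMod p) ≠ 0 := by
    rw [Ne, ZMod.natCast_eq_zero_iff]
    exact fun hd => (Nat.Prime.coprime_iff_not_dvd Fact.out).mp h.symm hd
  let b : ℕ := (-(s : ZMod p)⁻¹).val
  have hb : (b : ZMod p) = -(s : ZMod p)⁻¹ := ZMod.natCast_zmod_val _
  have hz : ((b * s + 1 : ℤ) : ZMod p) = 0 := by
    push_cast
    rw [hb, neg_mul, inv_mul_cancel₀ hs, neg_add_cancel]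
  obtain ⟨c, hc⟩ := (ZMod.intCast_zmod_eq_zero_iff_dvd _ p).mp hz
  refine ⟨-c, b, Nat.pos_of_ne_zero fun h0 => ?_, ZMod.val_lt _, by linear_combination hc⟩
  rw [h0, Nat.cast_zero, eq_comm, neg_eq_zero, inv_eq_zero] at hb
  exact hs hb

namespace Valuation

variable {F Γ : Type*} [Field F] [LinearOrderedCommGroupWithZero Γ] (v : Valuation F Γ)

/-- The difference is `c` times a geometric sum whose summands have `b` factors, each of value at
most `v y`. It is applied to `σ y = y + n`. -/
lemma map_add_pow_sub_pow_le {y c : F} (hy : 1 ≤ v y) (hc : v c ≤ 1) (b : ℕ) :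
    v ((y + c) ^ (b + 1) - y ^ (b + 1)) ≤ v y ^ b := by
  rw [← (Commute.all (y + c) y).mul_geom_sum₂, add_sub_cancel_left, map_mul]
  refine mul_le_of_le_one_of_le hc (v.map_sum_le fun i hi => ?_)
  have h1 : v (y + c) ≤ v y := (v.map_add_le le_rfl (hc.trans hy))
  have hi' : i + (b - i) = b := by
    rw [Finset.mem_range] at hi
    omega
  rw [Nat.add_sub_cancel, map_mul, map_pow, map_pow]
  calc v (y + c) ^ i * v y ^ (b - i) ≤ v y ^ i * v y ^ (b - i) := by gcongr
    _ = v y ^ b := by rw [← pow_add, hi']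

/-- In the binomial expansion, the terms after the first two are negligible when `y` has a pole and
`c` has none. -/
lemma exists_add_pow_eq {y c : F} (hy : 1 < v y) (hc : v c ≤ 1)
    (hn : ∀ n : ℕ, v (n : F) ≤ 1) (b : ℕ) :
    ∃ e, (y + c) ^ (b + 1) = y ^ (b + 1) + (b + 1 : ℕ) * c * y ^ b + e ∧ v e < v y ^ b := by
  induction b with
  | zero => exact ⟨0, by simp, by simp⟩
  | succ b ih =>
    obtain ⟨e, he, hv⟩ := ih
    refine ⟨(b + 1 : ℕ) * c ^ 2 * y ^ b + e * y + e * c, ?_, ?_⟩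
    · rw [pow_succ, he]
      push_cast
      ring
    · have hlt : v y ^ b < v y ^ (b + 1) := pow_lt_pow_right₀ hy (Nat.lt_succ_self b)
      have hy0 : 0 < v y := zero_lt_one.trans hy
      refine v.map_add_lt (v.map_add_lt ?_ ?_) ?_
      · refine lt_of_le_of_lt ?_ hlt
        rw [map_mul, map_mul, map_pow, map_pow]
        exact mul_le_of_le_one_left (zero_le) (mul_le_one' (hn _) (pow_le_one' hc 2))
      · rw [map_mul, pow_succ]
        exact mul_lt_mul_of_pos_right hv hy0
      · rw [map_mul]
        exact lt_of_le_of_lt (mul_le_of_le_one_right (zero_le) hc) (hv.trans hlt)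

lemma map_add_pow_sub_pow_eq {y c : F} (hy : 1 < v y) (hc : v c = 1)
    (hn : ∀ n : ℕ, v (n : F) ≤ 1) {b : ℕ} (hb : v ((b + 1 : ℕ) : F) = 1) :
    v ((y + c) ^ (b + 1) - y ^ (b + 1)) = v y ^ b := by
  obtain ⟨e, he, hv⟩ := v.exists_add_pow_eq hy hc.le hn b
  have h : v ((b + 1 : ℕ) * c * y ^ b) = v y ^ b := by
    rw [map_mul, map_mul, hb, hc, map_pow, one_mul, one_mul]
  rw [he, add_assoc, add_sub_cancel_left, map_add_eq_of_lt_left _ (by rwa [h]), h]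

end Valuation

namespace Place

variable {k L : Type*} [Field k] [Field L] [Algebra k L] [Algebra (RatFunc k) L]
  [IsScalarTower k (RatFunc k) L] {Q : Place k L} (hx : 1 < Q.valuation (coord k L))
  {p : ℕ} [Fact p.Prime] {f : k[X]} {B : PowerBasis (RatFunc k) L}
  (hB : IsArtinSchreier p (algebraMap k[X] (RatFunc k) f) B)
  (hf : 0 < f.natDegree) (hfp : Nat.Coprime f.natDegree p)
include hx hB hf hfp

lemma one_lt_valuation_gen : 1 < Q.valuation B.gen := by
  rw [(valuation_coord_and_gen hx hB hf hfp).2, ← WithZero.exp_zero, WithZero.exp_lt_exp]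
  exact_mod_cast hf

/-- For `0 < j < p` the exponent is not divisible by `p`, so it is nonzero: an integral term with `j
≠ 0` vanishes at `Q`. -/
lemma valuation_term_le_exp_neg_one {r : RatFunc k} {j : ℕ} (hj0 : j ≠ 0) (hj : j < p)
    (h : Q.valuation (algebraMap (RatFunc k) L r * B.gen ^ j) ≤ 1) :
    Q.valuation (algebraMap (RatFunc k) L r * B.gen ^ j) ≤ WithZero.exp (-1) := by
  by_cases hr : r = 0
  · simp [hr]
  rw [valuation_term_eq_exp hx hB hf hfp hr] at h ⊢
  rw [← WithZero.exp_zero, WithZero.exp_le_exp] at h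
  rw [WithZero.exp_le_exp]
  have hne : (p : ℤ) * r.intDegree + f.natDegree * j ≠ 0 := by
    intro h0
    have h4 : (p : ℤ) ∣ f.natDegree * (j : ℤ) := ⟨-r.intDegree, by linear_combination h0⟩
    have h5 := IsCoprime.dvd_of_dvd_mul_left (Nat.isCoprime_iff_coprime.mpr hfp.symm) h4
    exact hj.not_ge (Nat.le_of_dvd (Nat.pos_of_ne_zero hj0) (Int.natCast_dvd_natCast.mp h5))
  omega

variable [CharP k p]

/-- Termwise, `σ` fixes the `j = 0` term. The others have order at least `1`, and passing from `y ^
j` to `(y + n) ^ j - y ^ j` adds at least `s`. -/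
lemma valuation_aut_sub_le (σ : L ≃ₐ[RatFunc k] L) {z : L} (hz : Q.valuation z ≤ 1) :
    Q.valuation (σ z - z) ≤ WithZero.exp (-(f.natDegree + 1 : ℤ)) := by
  have : CharP (RatFunc k) p := charP_of_injective_algebraMap (algebraMap k _).injective p
  obtain ⟨n, hn⟩ := hB.exists_aut_apply_gen σ
  obtain ⟨r, rfl⟩ := hB.exists_repr z
  have hterm := fun i hi => (valuation_term_le_sum hx hB hf hfp r (i := i) hi).trans hz
  rw [map_sum, ← Finset.sum_sub_distrib]
  refine Q.valuation.map_sum_le fun j hj => ?_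
  rw [map_mul, map_pow, hn, AlgEquiv.commutes, ← mul_sub]
  have hy := one_lt_valuation_gen hx hB hf hfp
  rcases j with - | j
  · simp
  have h1 := valuation_term_le_exp_neg_one hx hB hf hfp (Nat.succ_ne_zero j)
    (Finset.mem_range.mp hj) (hterm _ hj)
  rw [map_mul]
  have h2 := Q.valuation.map_add_pow_sub_pow_le hy.le (Q.valuation_intCast_le_one n) j
  have hyv := (valuation_coord_and_gen hx hB hf hfp).2
  calc _ ≤ Q.valuation (algebraMap (RatFunc k) L (r (j + 1))) * Q.valuation B.gen ^ j := by gcongr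
    _ = Q.valuation (algebraMap (RatFunc k) L (r (j + 1)) * B.gen ^ (j + 1)) *
        WithZero.exp (-(f.natDegree : ℤ)) := by
      rw [map_mul, map_pow, pow_succ, hyv, mul_assoc, mul_assoc, ← WithZero.exp_add]
      simp
    _ ≤ WithZero.exp (-1) * WithZero.exp (-(f.natDegree : ℤ)) := by gcongr
    _ = _ := by
      rw [← WithZero.exp_add]
      congr 1
      ring

lemma exists_valuation_aut_sub_eq {σ : L ≃ₐ[RatFunc k] L} (hσ : σ ≠ 1) :
    ∃ z, Q.valuation z ≤ 1 ∧ Q.valuation (σ z - z) = WithZero.exp (-(f.natDegree + 1 : ℤ)) := by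
  have : CharP (RatFunc k) p := charP_of_injective_algebraMap (algebraMap k _).injective p
  have : CharP L p := charP_of_injective_algebraMap (algebraMap k L).injective p
  obtain ⟨n, hn⟩ := hB.exists_aut_apply_gen σ
  have hn0 : (n : L) ≠ 0 := by
    intro h
    apply hσ
    have h1 : (σ : L →ₐ[RatFunc k] L) = AlgHom.id _ _ := B.algHom_ext (by simp [hn, h])
    ext w
    exact DFunLike.congr_fun h1 w
  obtain ⟨a, b, hb, hbp, hab⟩ := hfp.exists_mul_add_mul_eq_neg_one
  have hxv := (valuation_coord_and_gen hx hB hf hfp).1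
  have hyv := (valuation_coord_and_gen hx hB hf hfp).2
  -- For this uniformizer the gain is exactly `s`, as `b` and `n` are nonzero in `L`, hence units at
  -- `Q`.
  refine ⟨coord k L ^ a * B.gen ^ b, ?_, ?_⟩
  · rw [map_mul, map_pow, map_zpow₀, hxv, hyv, WithZero.exp_pow_eq, WithZero.exp_zpow_eq,
      ← WithZero.exp_add, ← WithZero.exp_zero, WithZero.exp_le_exp, hab]
    norm_num
  · obtain ⟨b, rfl⟩ := Nat.exists_eq_succ_of_ne_zero hb.ne'
    have hbL : (((b + 1 : ℕ) : ℤ) : L) ≠ 0 := by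
      rw [Int.cast_natCast, Ne, CharP.cast_eq_zero_iff L p]
      exact fun h => hbp.not_ge (Nat.le_of_dvd hb h)
    have hbv := Q.valuation_intCast_of_ne_zero hbL
    rw [Int.cast_natCast] at hbv
    have h1 := Q.valuation.map_add_pow_sub_pow_eq (one_lt_valuation_gen hx hB hf hfp)
      (Q.valuation_intCast_of_ne_zero hn0) (fun m => by
        have := Q.valuation_intCast_le_one (m : ℤ)
        rwa [Int.cast_natCast] at this) hbv
    rw [map_mul, map_pow, map_zpow₀, hn, AlgEquiv.commutes, ← mul_sub, map_mul, h1, map_zpow₀, hxv,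
      hyv, WithZero.exp_pow_eq, WithZero.exp_zpow_eq, ← WithZero.exp_add]
    congr 1
    push_cast at hab
    linear_combination hab

theorem ramificationGroup_eq_univ {i : ℤ} (hi : i ≤ f.natDegree) :
    Q.ramificationGroup (RatFunc k) i = Set.univ := by
  refine Set.eq_univ_of_forall fun σ z hz =>
    (valuation_aut_sub_le hx hB hf hfp σ hz).trans ?_
  rw [WithZero.exp_le_exp]
  omega

theorem ramificationGroup_eq_one {i : ℤ} (hi : f.natDegree < i) :
    Q.ramificationGroup (RatFunc k) i = {1} := by
  ext σ
  rw [Set.mem_singleton_iff]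
  constructor
  · intro h
    by_contra hσ
    obtain ⟨z, hz, hv⟩ := exists_valuation_aut_sub_eq hx hB hf hfp hσ
    have := h z hz
    rw [hv, WithZero.exp_le_exp] at this
    omega
  · rintro rfl z -
    simp

end Place

/-! ### Affine points: local parameters and unramifiedness. -/

namespace Place

variable {k L : Type*} [Field k] [Field L] [Algebra k L]

/-- The subalgebra `A` of `L` has fraction field `L`, and its localization at the place `Q` is
contained in the valuation ring of `Q` and has maximal ideal generated by `t`. -/
structure IsLocalModel (Q : Place k L) (A : Subalgebra k L) (t : L) : Prop where
  le_one : ∀ a ∈ A, Q.valuation a ≤ 1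
  exists_mul_mem : ∀ w : L, ∃ b ∈ A, b ≠ 0 ∧ b * w ∈ A
  mem : t ∈ A
  lt_one : Q.valuation t < 1
  exists_mul_eq : ∀ u ∈ A, Q.valuation u < 1 →
    ∃ c ∈ A, ∃ u' ∈ A, Q.valuation c = 1 ∧ c * u = t * u'

namespace IsLocalModel

variable {Q : Place k L} {A : Subalgebra k L} {t : L} (h : Q.IsLocalModel A t)
include h

lemma exists_valuation_eq_exp_neg {u : L} (hu : u ∈ A) (hu0 : u ≠ 0) :
    ∃ m : ℕ, Q.valuation u = WithZero.exp (-m : ℤ) := by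
  have h0 : Q.valuation u ≠ 0 := by simpa using hu0
  have h1 := h.le_one u hu
  rw [← WithZero.exp_log h0, ← WithZero.exp_zero, WithZero.exp_le_exp] at h1
  refine ⟨(-(WithZero.log (Q.valuation u))).toNat, ?_⟩
  rw [Int.toNat_of_nonneg (by omega), neg_neg, WithZero.exp_log h0]

/-- Factors of `t` are split off one at a time; each strictly lowers the order, which is a natural
number on `A`. -/
lemma exists_mul_eq_pow_mul {u : L} (hu : u ∈ A) (hu0 : u ≠ 0) : ∃ n : ℕ, ∃ c ∈ A, ∃ a ∈ A,
    Q.valuation c = 1 ∧ Q.valuation a = 1 ∧ c * u = t ^ n * a := by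
  obtain ⟨m, hm⟩ := h.exists_valuation_eq_exp_neg hu hu0
  induction m using Nat.strong_induction_on generalizing u with
  | _ m ih =>
    rcases (h.le_one u hu).eq_or_lt with h1 | h1
    · exact ⟨0, 1, one_mem _, u, hu, map_one _, h1, by ring⟩
    obtain ⟨c, hc, u', hu', hcv, he⟩ := h.exists_mul_eq u hu h1
    have hv : Q.valuation u = Q.valuation t * Q.valuation u' := by
      rw [← map_mul, ← he, map_mul, hcv, one_mul]
    have hu0' : u' ≠ 0 := by
      rintro rfl
      apply hu0
      simpa using hv
    obtain ⟨m', hm'⟩ := h.exists_valuation_eq_exp_neg hu' hu0'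
    have hlt : m' < m := by
      have h2 : Q.valuation u < Q.valuation u' := by
        rw [hv]
        exact mul_lt_of_lt_one_left (by simpa [zero_lt_iff] using hu0') h.lt_one
      rw [hm, hm', WithZero.exp_lt_exp] at h2
      omega
    obtain ⟨n, c', hc', a, ha, hcv', hav, he'⟩ := ih m' hlt hu' hu0' hm'
    refine ⟨n + 1, c' * c, mul_mem hc' hc, a, ha, ?_, hav, ?_⟩
    · rw [map_mul, hcv, hcv', one_mul]
    · linear_combination c' * he + t * he'

lemma exists_eq_zpow_mul_div {w : L} (hw : w ≠ 0) (ht : t ≠ 0) : ∃ n : ℤ, ∃ c ∈ A, ∃ a ∈ A,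
    Q.valuation c = 1 ∧ Q.valuation a = 1 ∧ w = t ^ n * a / c := by
  obtain ⟨b, hb, hb0, hbw⟩ := h.exists_mul_mem w
  obtain ⟨n, c, hc, a, ha, hcv, hav, he⟩ := h.exists_mul_eq_pow_mul hb hb0
  obtain ⟨n', c', hc', a', ha', hcv', hav', he'⟩ :=
    h.exists_mul_eq_pow_mul hbw (mul_ne_zero hb0 hw)
  refine ⟨n' - n, c' * a, mul_mem hc' ha, a' * c, mul_mem ha' hc, ?_, ?_, ?_⟩
  · rw [map_mul, hcv', hav, one_mul]
  · rw [map_mul, hav', hcv, one_mul]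
  · have hne : ∀ z : L, Q.valuation z = 1 → z ≠ 0 := by
      rintro z hz rfl
      simp at hz
    have ha0 := hne a hav
    have hc0 := hne c' hcv'
    rw [zpow_sub₀ ht, zpow_natCast, zpow_natCast]
    field_simp
    linear_combination c * he' - c' * w * he

/-- If `t = 0`, then `exists_mul_eq` forces every nonzero element of `A` to have value `1`, so the
valuation has no poles, against surjectivity. -/
lemma ne_zero : t ≠ 0 := by
  rintro rfl
  have h1 : ∀ w, Q.valuation w ≤ 1 := by
    intro w
    obtain ⟨b, hb, hb0, hbw⟩ := h.exists_mul_mem w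
    have : Q.valuation b = 1 := by
      refine (h.le_one b hb).antisymm (not_lt.mp fun hlt => ?_)
      obtain ⟨c, hc, u', hu', hcv, he⟩ := h.exists_mul_eq b hb hlt
      rw [zero_mul] at he
      rcases mul_eq_zero.mp he with rfl | h0
      · simp at hcv
      · exact hb0 h0
    simpa [this] using h.le_one _ hbw
  obtain ⟨w, hw⟩ := Q.surjective (WithZero.exp 1)
  have := h1 w
  rw [hw, ← WithZero.exp_zero, WithZero.exp_le_exp] at this
  omega

/-- The generator of the maximal ideal of the local ring is a uniformizer. -/
theorem valuation_eq : Q.valuation t = WithZero.exp (-1) := by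
  obtain ⟨w, hw⟩ := Q.surjective (WithZero.exp (-1))
  have hw0 : w ≠ 0 := by
    rintro rfl
    rw [map_zero] at hw
    exact WithZero.exp_ne_zero hw.symm
  obtain ⟨n, c, hc, a, ha, hcv, hav, rfl⟩ := h.exists_eq_zpow_mul_div hw0 h.ne_zero
  have ht0 : Q.valuation t ≠ 0 := by simpa using h.ne_zero
  have hlt := h.lt_one
  rw [map_div₀, map_mul, map_zpow₀, hcv, hav, mul_one, div_one] at hw
  rw [← WithZero.exp_log ht0] at hw hlt ⊢
  rw [← WithZero.exp_zero, WithZero.exp_lt_exp] at hlt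
  rw [WithZero.exp_zpow_eq, WithZero.exp_inj] at hw
  rw [WithZero.exp_inj]
  have : -WithZero.log (Q.valuation t) ∣ 1 := ⟨n, by linear_combination hw⟩
  have := Int.eq_one_of_dvd_one (by omega) this
  omega

/-- The valuation ring is the localization of `A`. -/
theorem exists_eq_div {w : L} (hw : Q.valuation w ≤ 1) : ∃ a ∈ A, ∃ c ∈ A,
    Q.valuation c = 1 ∧ w = a / c := by
  by_cases hw0 : w = 0
  · exact ⟨0, zero_mem _, 1, one_mem _, map_one _, by simp [hw0]⟩
  obtain ⟨n, c, hc, a, ha, hcv, hav, rfl⟩ := h.exists_eq_zpow_mul_div hw0 h.ne_zero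
  rw [map_div₀, map_mul, map_zpow₀, hcv, hav, mul_one, div_one, h.valuation_eq,
    WithZero.exp_zpow_eq, ← WithZero.exp_zero, WithZero.exp_le_exp] at hw
  lift n to ℕ using by omega
  exact ⟨t ^ n * a, mul_mem (pow_mem h.mem n) ha, c, hc, hcv, by rw [zpow_natCast]⟩

/-- A derivation preserving `A` preserves the valuation ring. -/
theorem derivation_le_one (D : Derivation k L L) (hD : ∀ a ∈ A, D a ∈ A) {w : L}
    (hw : Q.valuation w ≤ 1) : Q.valuation (D w) ≤ 1 := by
  obtain ⟨a, ha, c, hc, hcv, rfl⟩ := h.exists_eq_div hw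
  rw [Derivation.leibniz_div, smul_eq_mul, map_mul, map_pow, map_inv₀, hcv, inv_one, one_pow,
    one_mul]
  exact h.le_one _ (sub_mem (mul_mem hc (hD a ha)) (mul_mem ha (hD c hc)))

end IsLocalModel

lemma valuation_aeval_le_one (Q : Place k L) {w : L} (hw : Q.valuation w ≤ 1) (q : k[X]) :
    Q.valuation (aeval w q) ≤ 1 := by
  rw [aeval_eq_sum_range]
  refine Q.valuation.map_sum_le fun i _ => ?_
  rw [Algebra.smul_def, map_mul, map_pow]
  exact mul_le_one' (Q.valuation_le_one_algebraMap _) (pow_le_one' hw i)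

/-- Over `k` the polynomial splits, and a product of linear factors vanishing at `Q` has a factor
vanishing at `Q`. -/
lemma exists_root_of_valuation_aeval_lt_one [IsAlgClosed k] (Q : Place k L) {w : L} {q : k[X]}
    (hq : q ≠ 0) (h : Q.valuation (aeval w q) < 1) :
    ∃ b, q.eval b = 0 ∧ Q.valuation (w - algebraMap k L b) < 1 := by
  by_contra! H
  have h1 : ∀ S : Multiset k, (∀ b ∈ S, 1 ≤ Q.valuation (w - algebraMap k L b)) →
      1 ≤ Q.valuation (aeval w (S.map fun b => X - C b).prod) := by
    intro S
    induction S using Multiset.induction_on with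
    | empty => simp
    | cons b S ih =>
      intro hS
      rw [Multiset.map_cons, Multiset.prod_cons, map_mul, map_mul]
      refine one_le_mul (by simpa using hS b (Multiset.mem_cons_self b S)) (ih fun c hc => ?_)
      exact hS c (Multiset.mem_cons_of_mem hc)
  have h2 := (IsAlgClosed.splits q).eq_prod_roots
  rw [h2, map_mul, map_mul, aeval_C, Q.trivial_on_constants _ (leadingCoeff_ne_zero.mpr hq),
    one_mul] at h
  exact h.not_ge (h1 _ fun b hb => H b (isRoot_of_mem_roots hb))

section Affine

variable [Algebra (RatFunc k) L] [IsScalarTower k (RatFunc k) L]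
  {Q : Place k L} (hx : Q.valuation (coord k L) ≤ 1)
  {p : ℕ} [Fact p.Prime] [CharP k p] {f : k[X]} {B : PowerBasis (RatFunc k) L}
  (hB : IsArtinSchreier p (algebraMap k[X] (RatFunc k) f) B)
include hB

omit [Fact p.Prime] [CharP k p] in
lemma gen_pow_sub_gen : B.gen ^ p - B.gen = aeval (coord k L) f := by
  rw [hB.gen, algebraMap_polynomial]

omit [Fact p.Prime] [CharP k p] [IsScalarTower k (RatFunc k) L] hB in
lemma aeval_coord_mem (q : k[X]) (y : L) :
    aeval (coord k L) q ∈ Algebra.adjoin k {coord k L, y} := by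
  have h : (Algebra.adjoin k {coord k L}) ≤ Algebra.adjoin k {coord k L, y} :=
    Algebra.adjoin_mono (by simp)
  exact h (aeval_mem_adjoin_singleton k _)

omit [Fact p.Prime] [CharP k p] in
lemma exists_mul_mem_adjoin (w : L) : ∃ b ∈ Algebra.adjoin k {coord k L, B.gen}, b ≠ 0 ∧
    b * w ∈ Algebra.adjoin k {coord k L, B.gen} := by
  obtain ⟨r, rfl⟩ := hB.exists_repr w
  induction Finset.range p using Finset.induction_on with
  | empty => exact ⟨1, one_mem _, one_ne_zero, by simp⟩
  | insert j T hj ih =>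
    obtain ⟨b, hb, hb0, hbw⟩ := ih
    have hden : algebraMap k[X] (RatFunc k) (r j).denom ≠ 0 := by
      simpa using (r j).denom_ne_zero
    have hdL : aeval (coord k L) (r j).denom ≠ 0 := by
      rw [← algebraMap_polynomial]
      simpa using hden
    refine ⟨b * aeval (coord k L) (r j).denom, mul_mem hb (aeval_coord_mem _ _),
      mul_ne_zero hb0 hdL, ?_⟩
    have h1 : aeval (coord k L) (r j).denom * algebraMap (RatFunc k) L (r j) =
        aeval (coord k L) (r j).num := by
      rw [← algebraMap_polynomial, ← algebraMap_polynomial, ← map_mul]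
      congr 1
      rw [mul_comm]
      exact ((div_eq_iff hden).mp (RatFunc.num_div_denom (r j))).symm
    rw [Finset.sum_insert hj]
    have h2 : b * aeval (coord k L) (r j).denom * (algebraMap (RatFunc k) L (r j) * B.gen ^ j +
        ∑ x ∈ T, algebraMap (RatFunc k) L (r x) * B.gen ^ x) =
        b * aeval (coord k L) (r j).num * B.gen ^ j + aeval (coord k L) (r j).denom *
        (b * ∑ x ∈ T, algebraMap (RatFunc k) L (r x) * B.gen ^ x) := by
      rw [← h1]
      ring
    rw [h2]
    exact add_mem (mul_mem (mul_mem hb (aeval_coord_mem _ _))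
      (pow_mem (Algebra.subset_adjoin (by simp)) j)) (mul_mem (aeval_coord_mem _ _) hbw)

include hx

omit [CharP k p] in
lemma valuation_gen_le_one : Q.valuation B.gen ≤ 1 := by
  have hp : p.Prime := Fact.out
  by_contra! h
  have h1 : Q.valuation (B.gen ^ p - B.gen) ≤ 1 := by
    rw [gen_pow_sub_gen hB]
    exact Q.valuation_aeval_le_one hx f
  rw [Q.valuation.map_sub_eq_of_lt_left, map_pow] at h1
  · exact (one_lt_pow₀ h hp.ne_zero).not_ge h1
  · rw [map_pow]
    exact lt_self_pow₀ h hp.one_lt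

omit [CharP k p] in
lemma adjoin_le_one {u : L} (hu : u ∈ Algebra.adjoin k {coord k L, B.gen}) :
    Q.valuation u ≤ 1 := by
  induction hu using Algebra.adjoin_induction with
  | mem z hz =>
    rcases hz with rfl | rfl
    · exact hx
    · exact valuation_gen_le_one hx hB
  | algebraMap c => exact Q.valuation_le_one_algebraMap c
  | add a b _ _ ha hb => exact Q.valuation.map_add_le ha hb
  | mul a b _ _ ha hb => rw [map_mul]; exact mul_le_one' ha hb

omit [CharP k p] in
lemma exists_valuation_aeval_lt_one : ∃ q : k[X], q ≠ 0 ∧ Q.valuation (aeval (coord k L) q) < 1 := by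
  -- Otherwise all nonzero polynomials in `x` are units at `Q`; then `k(x)`, and with it all of `L`,
  -- has no pole at `Q`.
  by_contra! H
  have h1 : ∀ w : L, w ∈ Q.ring := by
    intro w
    obtain ⟨r, rfl⟩ := hB.exists_repr w
    refine sum_mem fun j _ => mul_mem ?_ (pow_mem (valuation_gen_le_one hx hB) j)
    rw [← RatFunc.num_div_denom (r j), map_div₀, algebraMap_polynomial, algebraMap_polynomial]
    change Q.valuation _ ≤ 1
    rw [map_div₀, (Q.valuation_aeval_le_one hx _).antisymm (H _ (r j).denom_ne_zero), div_one]
    exact Q.valuation_aeval_le_one hx _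
  obtain ⟨w, hw⟩ := Q.surjective (WithZero.exp 1)
  have : Q.valuation w ≤ 1 := h1 w
  rw [hw, ← WithZero.exp_zero, WithZero.exp_le_exp] at this
  omega

/-- At an affine point with `x`-coordinate `a`, the function `x - a` is a local parameter. -/
theorem exists_isLocalModel [IsAlgClosed k] : ∃ a : k,
    Q.IsLocalModel (Algebra.adjoin k {coord k L, B.gen}) (coord k L - algebraMap k L a) := by
  have hp : p.Prime := Fact.out
  have : CharP L p := charP_of_injective_algebraMap (algebraMap k L).injective p
  obtain ⟨q, hq, hqv⟩ := exists_valuation_aeval_lt_one hx hB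
  obtain ⟨a, -, ha⟩ := Q.exists_root_of_valuation_aeval_lt_one hq hqv
  obtain ⟨g, hg⟩ := X_sub_C_dvd_sub_C_eval (a := a) (p := f)
  have hg' := congrArg (aeval (coord k L)) hg
  simp only [map_sub, map_mul, aeval_C, aeval_X] at hg'
  set x := coord k L with hxdef
  set t := x - algebraMap k L a with ht
  have hroot : Q.valuation (aeval B.gen (X ^ p - X - C (f.eval a))) < 1 := by
    have h1 : aeval B.gen (X ^ p - X - C (f.eval a)) = t * aeval x g := by
      rw [← hg', ← gen_pow_sub_gen hB]
      simp
    rw [h1, map_mul]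
    exact mul_lt_one_of_lt_of_le ha (Q.valuation_aeval_le_one hx g)
  obtain ⟨b, hb, hbv⟩ := Q.exists_root_of_valuation_aeval_lt_one
    (monic_X_pow_sub_X_sub_C p _).ne_zero hroot
  set z := B.gen - algebraMap k L b with hz
  have hxA : x ∈ Algebra.adjoin k {x, B.gen} := Algebra.subset_adjoin (by simp)
  have hyA : B.gen ∈ Algebra.adjoin k {x, B.gen} := Algebra.subset_adjoin (by simp)
  have htA : t ∈ Algebra.adjoin k {x, B.gen} := sub_mem hxA (Subalgebra.algebraMap_mem _ a)
  have hzA : z ∈ Algebra.adjoin k {x, B.gen} := sub_mem hyA (Subalgebra.algebraMap_mem _ b)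
  -- Subtracting the equation at `(a, b)` gives `z ^ p - z = f(x) - f(a) = t g(x)`. As `z` vanishes
  -- at `Q`, the cofactor of `z` is a unit there, so `z` is a local multiple of `t`.
  have hzt : (z ^ (p - 1) - 1) * z = t * aeval x g := by
    rw [sub_mul, ← pow_succ, Nat.sub_add_cancel hp.one_le, one_mul, ← hg', hz, sub_pow_char,
      ← gen_pow_sub_gen hB]
    have hb' : f.eval a = b ^ p - b := by
      simp only [eval_sub, eval_pow, eval_X, eval_C] at hb
      linear_combination -hb
    rw [hb', map_sub, map_pow]
    ring
  have hcv : Q.valuation (z ^ (p - 1) - 1) = 1 := by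
    rw [Q.valuation.map_sub_eq_of_lt_right, map_one]
    rw [map_one, map_pow]
    exact pow_lt_one₀ (zero_le) hbv (by have := hp.two_le; omega)
  -- Every element of the coordinate ring is its constant value at `(a, b)` modulo the ideal `(t,
  -- z)`; when it vanishes at `Q`, this constant is `0`.
  have hdec : ∀ u ∈ Algebra.adjoin k {x, B.gen}, ∃ c : k, ∃ α ∈ Algebra.adjoin k {x, B.gen},
      ∃ β ∈ Algebra.adjoin k {x, B.gen}, u = algebraMap k L c + t * α + z * β := by
    intro u hu
    induction hu using Algebra.adjoin_induction with
    | mem w hw =>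
      rcases hw with rfl | rfl
      · exact ⟨a, 1, one_mem _, 0, zero_mem _, by rw [ht]; ring⟩
      · exact ⟨b, 0, zero_mem _, 1, one_mem _, by rw [hz]; ring⟩
    | algebraMap c => exact ⟨c, 0, zero_mem _, 0, zero_mem _, by ring⟩
    | add u v _ _ hu hv =>
      obtain ⟨c, α, hα, β, hβ, rfl⟩ := hu
      obtain ⟨c', α', hα', β', hβ', rfl⟩ := hv
      exact ⟨c + c', α + α', add_mem hα hα', β + β', add_mem hβ hβ', by rw [map_add]; ring⟩
    | mul u v huA _ hu hv =>
      obtain ⟨c, α, hα, β, hβ, hu⟩ := hu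
      obtain ⟨c', α', hα', β', hβ', rfl⟩ := hv
      refine ⟨c * c', algebraMap k L c' * α + u * α', ?_, algebraMap k L c' * β + u * β', ?_, ?_⟩
      · exact add_mem (mul_mem (Subalgebra.algebraMap_mem _ _) hα) (mul_mem huA hα')
      · exact add_mem (mul_mem (Subalgebra.algebraMap_mem _ _) hβ) (mul_mem huA hβ')
      · rw [map_mul]
        linear_combination algebraMap k L c' * hu
  refine ⟨a, fun _ => adjoin_le_one hx hB, exists_mul_mem_adjoin hB, htA, ha, ?_⟩
  intro u hu huv
  obtain ⟨c, α, hα, β, hβ, rfl⟩ := hdec u hu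
  have hc : c = 0 := by
    by_contra hc
    have h1 : Q.valuation (t * α + z * β) < 1 := by
      refine Q.valuation.map_add_lt ?_ ?_ <;> rw [map_mul]
      · exact mul_lt_one_of_lt_of_le ha (adjoin_le_one hx hB hα)
      · exact mul_lt_one_of_lt_of_le hbv (adjoin_le_one hx hB hβ)
    rw [add_assoc, Q.valuation.map_add_eq_of_lt_left, Q.trivial_on_constants c hc] at huv
    · exact lt_irrefl _ huv
    · rwa [Q.trivial_on_constants c hc]
  refine ⟨z ^ (p - 1) - 1, sub_mem (pow_mem hzA _) (one_mem _),
    (z ^ (p - 1) - 1) * α + aeval x g * β, add_mem (mul_mem (sub_mem (pow_mem hzA _) (one_mem _)) hα)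
    (mul_mem (aeval_coord_mem g _) hβ), hcv, ?_⟩
  rw [hc, map_zero]
  linear_combination β * hzt

theorem isUnramified_of_le_one [IsAlgClosed k] : Q.IsUnramified (RatFunc k) := by
  obtain ⟨a, h⟩ := exists_isLocalModel hx hB
  -- The restriction to `k(x)` is already normalized, because the uniformizer `x - a` lies in
  -- `k(x)`.
  refine ⟨⟨Q.valuation.comap (algebraMap (RatFunc k) L), ?_, ?_⟩, ?_, ?_⟩
  · intro γ
    induction γ using WithZero.expRecOn with
    | zero => exact ⟨0, map_zero _⟩
    | exp n =>
      refine ⟨(RatFunc.X - algebraMap k (RatFunc k) a) ^ (-n), ?_⟩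
      have h1 := h.valuation_eq
      rw [map_zpow₀, Valuation.comap_apply, map_sub, ← IsScalarTower.algebraMap_apply, h1,
        WithZero.exp_zpow_eq]
      simp
  · intro c hc
    rw [Valuation.comap_apply, ← IsScalarTower.algebraMap_apply]
    exact Q.trivial_on_constants c hc
  · rfl
  · intro w
    rw [pow_one]
    rfl

end Affine

end Place

/-! ### Places from Dedekind domains: a point over infinity, and integrality from affine regularity.
-/

namespace Place

variable {k L : Type*} [Field k] [Field L] [Algebra k L]

/-- The place given by a nonzero prime ideal of a Dedekind domain with fraction field `L`
containing the constants. -/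
noncomputable def ofHeightOneSpectrum {C : Type*} [CommRing C] [IsDedekindDomain C] [Algebra C L]
    [IsFractionRing C L] (hk : ∀ c : k, algebraMap k L c ∈ (algebraMap C L).range)
    (v : IsDedekindDomain.HeightOneSpectrum C) : Place k L where
  valuation := v.valuation L
  surjective := v.valuation_surjective L
  trivial_on_constants c hc := by
    have hle : ∀ c : k, v.valuation L (algebraMap k L c) ≤ 1 := by
      intro c
      obtain ⟨u, hu⟩ := hk c
      rw [← hu]
      exact v.valuation_le_one u
    refine (hle c).antisymm ?_
    have h1 := hle c⁻¹
    rw [map_inv₀, map_inv₀] at h1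
    exact (inv_le_one₀ (by simpa [zero_lt_iff] using hc)).mp h1

instance (Q : Place k L) : Q.valuation.IsNontrivial := by
  obtain ⟨w, hw⟩ := Q.surjective (WithZero.exp 1)
  refine ⟨w, by simp [hw], ?_⟩
  rw [hw, Ne, WithZero.exp_eq_one]
  exact one_ne_zero

instance (Q : Place k L) : IsDedekindDomain Q.ring := by
  have : Nontrivial (MonoidWithZeroHom.valueGroup (.ofClass Q.valuation)) := inferInstance
  infer_instance

variable [Algebra (RatFunc k) L] [IsScalarTower k (RatFunc k) L]
  [FiniteDimensional (RatFunc k) L] [Algebra.IsSeparable (RatFunc k) L]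

variable (k L) in
/-- There is a point over infinity. -/
theorem exists_one_lt_coord : ∃ Q : Place k L, 1 < Q.valuation (coord k L) := by
  let R := (infinity k).ring
  let C := integralClosure R L
  have : IsDedekindDomain C := IsIntegralClosure.isDedekindDomain R (RatFunc k) L C
  have : IsFractionRing C L :=
    IsIntegralClosure.isFractionRing_of_finite_extension R (RatFunc k) L C
  have hk : ∀ c : k, algebraMap k L c ∈ (algebraMap C L).range := by
    intro c
    have : IsIntegral R (algebraMap k L c) := by
      rw [IsScalarTower.algebraMap_apply k (RatFunc k) L]
      exact isIntegral_algebraMap (x := (⟨_, (infinity k).algebraMap_mem_ring c⟩ : R))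
    exact ⟨⟨_, this⟩, rfl⟩
  have hX : (infinity k).valuation RatFunc.X = WithZero.exp 1 := by
    rw [infinity_valuation_of_ne_zero RatFunc.X_ne_zero, RatFunc.intDegree_X]
  let ϖ : R := ⟨RatFunc.X⁻¹, by
    change (infinity k).valuation _ ≤ 1
    rw [map_inv₀, hX, ← WithZero.exp_neg, ← WithZero.exp_zero, WithZero.exp_le_exp]
    norm_num⟩
  have hϖL : algebraMap C L (algebraMap R C ϖ) = (coord k L)⁻¹ := by
    rw [← IsScalarTower.algebraMap_apply R C L, IsScalarTower.algebraMap_apply R (RatFunc k) L,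
      coord, ← map_inv₀]
    rfl
  have hx0 : coord k L ≠ 0 := by simp [coord, RatFunc.X_ne_zero]
  -- Were `1 / x` a unit in the integral closure `C`, then `x` would be integral over the integrally
  -- closed ring `R`, where it has a pole. A maximal ideal of `C` containing `1 / x` then gives the
  -- place.
  have hnu : algebraMap R C ϖ ∈ nonunits C := by
    intro hu
    obtain ⟨u, hu⟩ := hu.exists_right_inv
    have h1 : algebraMap C L u = coord k L := by
      have := congrArg (algebraMap C L) hu
      rw [map_mul, hϖL, map_one] at this
      field_simp at this
      exact this
    have h2 : IsIntegral R (coord k L) := h1 ▸ u.2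
    rw [coord, isIntegral_algebraMap_iff (algebraMap (RatFunc k) L).injective] at h2
    obtain ⟨r, hr⟩ := IsIntegrallyClosed.isIntegral_iff.mp h2
    have h3 : (infinity k).valuation RatFunc.X ≤ 1 := hr ▸ r.2
    rw [hX, ← WithZero.exp_zero, WithZero.exp_le_exp] at h3
    omega
  obtain ⟨M, hM, hmem⟩ := exists_max_ideal_of_mem_nonunits hnu
  have hϖ0 : algebraMap R C ϖ ≠ 0 := by
    intro h0
    rw [h0, map_zero] at hϖL
    exact inv_ne_zero hx0 hϖL.symm
  let v : IsDedekindDomain.HeightOneSpectrum C :=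
    ⟨M, hM.isPrime, fun hb => hϖ0 (by rw [hb] at hmem; exact hmem)⟩
  refine ⟨ofHeightOneSpectrum hk v, ?_⟩
  have h4 : v.valuation L (algebraMap C L (algebraMap R C ϖ)) < 1 :=
    (v.valuation_lt_one_iff_mem _).mpr hmem
  rw [hϖL, map_inv₀] at h4
  exact (inv_lt_one₀ (by simpa [zero_lt_iff] using hx0)).mp h4

variable [Algebra k[X] L] [IsScalarTower k[X] (RatFunc k) L]

/-- A function without affine poles is integral over `k[x]`. -/
theorem isIntegral_of_forall_le_one {w : L}
    (hw : ∀ Q : Place k L, Q.valuation (coord k L) ≤ 1 → Q.valuation w ≤ 1) :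
    IsIntegral k[X] w := by
  let C := integralClosure k[X] L
  have : IsDedekindDomain C := IsIntegralClosure.isDedekindDomain k[X] (RatFunc k) L C
  have : IsFractionRing C L :=
    IsIntegralClosure.isFractionRing_of_finite_extension k[X] (RatFunc k) L C
  have hpoly : ∀ q : k[X], algebraMap k[X] L q ∈ (algebraMap C L).range := fun q =>
    ⟨⟨_, isIntegral_algebraMap⟩, rfl⟩
  have hk : ∀ c : k, algebraMap k L c ∈ (algebraMap C L).range := by
    intro c
    have := hpoly (Polynomial.C c)
    rwa [IsScalarTower.algebraMap_apply k[X] (RatFunc k) L, algebraMap_polynomial, aeval_C] at this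
  have hX : coord k L ∈ (algebraMap C L).range := by
    have := hpoly X
    rwa [IsScalarTower.algebraMap_apply k[X] (RatFunc k) L, algebraMap_polynomial, aeval_X] at this
  obtain ⟨c, hc⟩ := IsDedekindDomain.HeightOneSpectrum.mem_integers_of_valuation_le_one (R := C) L w
    fun v => hw (ofHeightOneSpectrum hk v) (by
      obtain ⟨u, hu⟩ := hX
      rw [← hu]
      exact v.valuation_le_one u)
  rw [← hc]
  exact c.2

end Place

/-! ### Differentials: the generator `dx` and orders of derivatives. -/

section Differentials

variable {k L : Type u} [Field k] [Field L] [Algebra k L] [Algebra (RatFunc k) L]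
  [Algebra k[X] L] [IsScalarTower k[X] (RatFunc k) L]

variable (k L) in
/-- The differentials of a separable extension of `k(x)` are freely generated by `dx`. -/
theorem KaehlerDifferential.exists_equiv_of_isSeparable [Algebra.IsSeparable (RatFunc k) L]
    [IsScalarTower k k[X] L] :
    ∃ e : Ω[L⁄k] ≃ₗ[L] L, e (D k L (Place.coord k L)) = 1 := by
  -- Both `k[x] → k(x)` and `k(x) → L` are formally étale, so the differentials of `L` are
  -- base-changed from `k[x]`.
  have : Algebra.FormallyEtale (RatFunc k) L := Algebra.FormallyEtale.of_isSeparable _ _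
  have : Algebra.FormallyEtale k[X] (RatFunc k) :=
    Algebra.FormallyEtale.of_isLocalization (nonZeroDivisors k[X])
  have : Algebra.FormallyEtale k[X] L := Algebra.FormallyEtale.comp k[X] (RatFunc k) L
  refine ⟨(tensorKaehlerEquivOfFormallyEtale k k[X] L).symm ≪≫ₗ
    (TensorProduct.AlgebraTensorModule.congr (LinearEquiv.refl L L) (polynomialEquiv k)) ≪≫ₗ
    (TensorProduct.AlgebraTensorModule.rid k[X] L L), ?_⟩
  have hx : Place.coord k L = algebraMap k[X] L X := by
    rw [Place.coord, IsScalarTower.algebraMap_apply k[X] (RatFunc k) L, RatFunc.algebraMap_X]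
  rw [hx, LinearEquiv.trans_apply, LinearEquiv.trans_apply,
    tensorKaehlerEquivOfFormallyEtale_symm_D_algebraMap]
  simp

end Differentials

namespace Place

variable {k L : Type*} [Field k] [Field L] [Algebra k L]

section Regular

variable (e : Ω[L⁄k] ≃ₗ[L] L) {Q : Place k L} {ω : Ω[L⁄k]}

/-- With the next lemma, this turns regularity into an inequality, once some `dt` attains the
largest value among all `dt` with `t` integral. -/
lemma IsRegularAt.valuation_le (hω : Q.IsRegularAt ω) {γ : ℤᵐ⁰}
    (h : ∀ t, Q.valuation t ≤ 1 → Q.valuation (e (D k L t)) ≤ γ) : Q.valuation (e ω) ≤ γ := by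
  induction hω using Submodule.span_induction with
  | mem z hz =>
    obtain ⟨t, rfl⟩ := hz
    exact h t t.2
  | zero => simp
  | add a b _ _ ha hb =>
    rw [map_add]
    exact Q.valuation.map_add_le ha hb
  | smul c a _ ha =>
    have : e (c • a) = (c : L) * e a := e.map_smul (c : L) a
    rw [this, map_mul]
    exact mul_le_of_le_one_of_le c.2 ha

lemma isRegularAt_of_valuation_le {t : L} (ht : Q.valuation t ≤ 1) (ht0 : e (D k L t) ≠ 0)
    (h : Q.valuation (e ω) ≤ Q.valuation (e (D k L t))) : Q.IsRegularAt ω := by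
  have hc : Q.valuation (e ω / e (D k L t)) ≤ 1 := by
    rw [map_div₀]
    exact div_le_one_of_le₀ h (zero_le)
  have h1 : ω = (⟨_, hc⟩ : Q.ring) • D k L ((⟨t, ht⟩ : Q.ring) : L) := by
    apply e.injective
    change _ = e ((e ω / e (D k L t)) • D k L t)
    rw [map_smul, smul_eq_mul, div_mul_cancel₀ _ ht0]
  rw [h1]
  exact Submodule.smul_mem _ _ (Submodule.subset_span ⟨_, rfl⟩)

end Regular

lemma _root_.Derivation.leibniz_mul_pow_succ (δ : Derivation k L L) (r y : L) (j : ℕ) :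
    δ (r * y ^ (j + 1)) = r * ((j + 1 : ℕ) * y ^ j * δ y) + δ r * y ^ (j + 1) := by
  rw [Derivation.leibniz, Derivation.leibniz_pow, Nat.add_sub_cancel, smul_eq_mul, smul_eq_mul,
    smul_eq_mul, nsmul_eq_mul]
  ring

variable [Algebra (RatFunc k) L] [IsScalarTower k (RatFunc k) L]
  (δ : Derivation k L L) (hδ : δ (coord k L) = 1) {Q : Place k L}
  {p : ℕ} {f : k[X]} {B : PowerBasis (RatFunc k) L}
  (hB : IsArtinSchreier p (algebraMap k[X] (RatFunc k) f) B)

include hδ in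
omit [IsScalarTower k (RatFunc k) L] in
lemma derivation_aeval_coord (q : k[X]) :
    δ (aeval (coord k L) q) = aeval (coord k L) (derivative q) := by
  rw [Derivation.map_aeval, hδ, smul_eq_mul, mul_one]

include hδ hB in
-- Differentiating `y ^ p - y = f(x)` kills the `p`th power.
lemma derivation_gen [CharP k p] : δ B.gen = -aeval (coord k L) (derivative f) := by
  have : CharP L p := charP_of_injective_algebraMap (algebraMap k L).injective p
  have h := congrArg δ (gen_pow_sub_gen hB)
  rw [derivation_aeval_coord δ hδ, map_sub, Derivation.leibniz_pow, ← Nat.cast_smul_eq_nsmul L,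
    CharP.cast_eq_zero, zero_smul, zero_sub] at h
  rw [← h, neg_neg]

include hδ hB in
lemma derivation_mem_adjoin [CharP k p] {u : L}
    (hu : u ∈ Algebra.adjoin k {coord k L, B.gen}) :
    δ u ∈ Algebra.adjoin k {coord k L, B.gen} := by
  induction hu using Algebra.adjoin_induction with
  | mem z hz =>
    rcases hz with rfl | rfl
    · rw [hδ]
      exact one_mem _
    · rw [derivation_gen δ hδ hB]
      exact neg_mem (aeval_coord_mem _ _)
  | algebraMap c =>
    rw [Derivation.map_algebraMap]
    exact zero_mem _
  | add a b _ _ ha hb =>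
    rw [map_add]
    exact add_mem ha hb
  | mul a b ha' hb' ha hb =>
    rw [Derivation.leibniz]
    exact add_mem (mul_mem ha' hb) (mul_mem hb' ha)

section Infinity

variable (hx : 1 < Q.valuation (coord k L)) [Fact p.Prime]
  (hf : 0 < f.natDegree) (hfp : Nat.Coprime f.natDegree p)

include hx in
omit [IsScalarTower k (RatFunc k) L] [Fact p.Prime] in
lemma valuation_aeval_derivative_le (q : k[X]) :
    Q.valuation (aeval (coord k L) (derivative q)) ≤
      Q.valuation (aeval (coord k L) q) * (Q.valuation (coord k L))⁻¹ := by
  by_cases hq : derivative q = 0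
  · simp [hq]
  have hdeg : q.natDegree ≠ 0 := fun h => hq (derivative_of_natDegree_zero h)
  have hq0 : q ≠ 0 := by rintro rfl; simp at hq
  have hx0 : Q.valuation (coord k L) ≠ 0 := ne_zero_of_lt hx
  rw [valuation_aeval_of_one_lt hx hq, valuation_aeval_of_one_lt hx hq0]
  obtain ⟨d, hd⟩ := Nat.exists_eq_succ_of_ne_zero hdeg
  rw [hd, pow_succ, mul_assoc, mul_inv_cancel₀ hx0, mul_one]
  refine pow_le_pow_right₀ hx.le ?_
  have := natDegree_derivative_lt hdeg
  omega

include hδ hx in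
omit [Fact p.Prime] in
lemma valuation_derivation_algebraMap_le (r : RatFunc k) :
    Q.valuation (δ (algebraMap (RatFunc k) L r)) ≤
      Q.valuation (algebraMap (RatFunc k) L r) * (Q.valuation (coord k L))⁻¹ := by
  rw [← RatFunc.num_div_denom r, map_div₀, algebraMap_polynomial, algebraMap_polynomial,
    Derivation.leibniz_div, derivation_aeval_coord δ hδ, derivation_aeval_coord δ hδ]
  have hd : Q.valuation (aeval (coord k L) r.denom) ≠ 0 := by
    rw [valuation_aeval_of_one_lt hx r.denom_ne_zero]
    exact pow_ne_zero _ (ne_zero_of_lt hx)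
  have h1 : Q.valuation (aeval (coord k L) r.denom • aeval (coord k L) (derivative r.num) -
      aeval (coord k L) r.num • aeval (coord k L) (derivative r.denom)) ≤
      Q.valuation (aeval (coord k L) r.num) * Q.valuation (aeval (coord k L) r.denom) *
        (Q.valuation (coord k L))⁻¹ := by
    refine Q.valuation.map_sub_le ?_ ?_
    · rw [smul_eq_mul, map_mul, mul_comm (Q.valuation (aeval (coord k L) r.num)), mul_assoc]
      gcongr
      exact valuation_aeval_derivative_le hx _
    · rw [smul_eq_mul, map_mul, mul_assoc]
      gcongr
      exact valuation_aeval_derivative_le hx _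
  rw [smul_eq_mul, map_mul, map_pow, map_inv₀, map_div₀]
  calc _ ≤ (Q.valuation (aeval (coord k L) r.denom))⁻¹ ^ 2 *
        (Q.valuation (aeval (coord k L) r.num) * Q.valuation (aeval (coord k L) r.denom) *
        (Q.valuation (coord k L))⁻¹) := by gcongr
    _ = _ := by field_simp

include hδ hx hB hf hfp

lemma valuation_derivation_gen [CharP k p] :
    Q.valuation (δ B.gen) = WithZero.exp (p * (f.natDegree - 1) : ℤ) := by
  have hp : p.Prime := Fact.out
  have hlc : derivative f ≠ 0 ∧ (derivative f).natDegree = f.natDegree - 1 := by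
    -- The leading coefficient of `f'` survives because `p` does not divide `deg f`.
    have hc : (derivative f).coeff (f.natDegree - 1) ≠ 0 := by
      rw [coeff_derivative, Nat.sub_add_cancel hf]
      refine mul_ne_zero (leadingCoeff_ne_zero.mpr (by rintro rfl; simp at hf)) ?_
      rw [← Nat.cast_succ, Nat.succ_eq_add_one, Nat.sub_add_cancel hf, Ne,
        CharP.cast_eq_zero_iff k p]
      exact fun hd => (Nat.Prime.coprime_iff_not_dvd hp).mp hfp.symm hd
    refine ⟨fun h => hc (by simp [h]), le_antisymm (natDegree_derivative_le f)
      (le_natDegree_of_ne_zero hc)⟩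
  rw [derivation_gen δ hδ hB, Valuation.map_neg, valuation_aeval_of_one_lt hx hlc.1, hlc.2,
    (valuation_coord_and_gen hx hB hf hfp).1, WithZero.exp_pow_eq, Nat.cast_sub hf, mul_comm,
    Nat.cast_one]

/-- The exponent is the order of `dx` at infinity, that is `(p - 1)(s - 1) - 2 = 2g - 2`. It arises
as `-1 - s + p (s - 1)`: a term of order at least `1` loses a factor `y` and gains `δ y`. -/
lemma valuation_derivation_le [CharP k p] {t : L} (ht : Q.valuation t ≤ 1) : Q.valuation (δ t) ≤
    WithZero.exp (p * f.natDegree - f.natDegree - p - 1 : ℤ) := by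
  have hp : (2 : ℤ) ≤ p := by exact_mod_cast (Fact.out : p.Prime).two_le
  have hs : (1 : ℤ) ≤ f.natDegree := by exact_mod_cast hf
  obtain ⟨hxv, hyv⟩ := valuation_coord_and_gen hx hB hf hfp
  obtain ⟨r, rfl⟩ := hB.exists_repr t
  have hterm := fun i hi => (valuation_term_le_sum hx hB hf hfp r (i := i) hi).trans ht
  rw [map_sum]
  refine Q.valuation.map_sum_le fun j hj => ?_
  have hr := valuation_derivation_algebraMap_le δ hδ hx (r j)
  rw [hxv, ← WithZero.exp_neg] at hr
  rcases j with - | j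
  · have h0 := hterm 0 hj
    rw [pow_zero, mul_one] at h0 ⊢
    calc _ ≤ 1 * WithZero.exp (-(p : ℤ)) := hr.trans (by gcongr)
      _ ≤ _ := by
        rw [one_mul, WithZero.exp_le_exp]
        nlinarith
  have h1 := valuation_term_le_exp_neg_one hx hB hf hfp (Nat.succ_ne_zero j)
    (Finset.mem_range.mp hj) (hterm _ hj)
  rw [Derivation.leibniz_mul_pow_succ]
  refine Q.valuation.map_add_le ?_ ?_
  · have hnat : Q.valuation ((j + 1 : ℕ) : L) ≤ 1 := by
      have := Q.valuation_intCast_le_one ((j + 1 : ℕ) : ℤ)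
      rwa [Int.cast_natCast] at this
    calc _ = Q.valuation ((j + 1 : ℕ) : L) * (Q.valuation (algebraMap (RatFunc k) L (r (j + 1)) *
          B.gen ^ (j + 1)) * (WithZero.exp (-(f.natDegree : ℤ)) * Q.valuation (δ B.gen))) := by
          simp only [map_mul, map_pow, pow_succ, WithZero.exp_neg, hyv]
          field_simp
      _ ≤ 1 * (WithZero.exp (-1) * (WithZero.exp (-(f.natDegree : ℤ)) * Q.valuation (δ B.gen))) := by
          gcongr
      _ = _ := by
          rw [one_mul, valuation_derivation_gen δ hδ hB hx hf hfp, ← WithZero.exp_add,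
            ← WithZero.exp_add]
          congr 1
          ring
  · rw [map_mul]
    calc _ ≤ Q.valuation (algebraMap (RatFunc k) L (r (j + 1))) * WithZero.exp (-(p : ℤ)) *
          Q.valuation (B.gen ^ (j + 1)) := by gcongr
      _ = Q.valuation (algebraMap (RatFunc k) L (r (j + 1)) * B.gen ^ (j + 1)) *
          WithZero.exp (-(p : ℤ)) := by rw [map_mul, mul_right_comm]
      _ ≤ WithZero.exp (-1) * WithZero.exp (-(p : ℤ)) := by gcongr
      _ ≤ _ := by
        rw [← WithZero.exp_add, WithZero.exp_le_exp]
        nlinarith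

lemma exists_valuation_derivation_eq [CharP k p] : ∃ t, Q.valuation t ≤ 1 ∧ Q.valuation (δ t) =
    WithZero.exp (p * f.natDegree - f.natDegree - p - 1 : ℤ) := by
  have : CharP L p := charP_of_injective_algebraMap (algebraMap k L).injective p
  have hp : (2 : ℤ) ≤ p := by exact_mod_cast (Fact.out : p.Prime).two_le
  have hs : (1 : ℤ) ≤ f.natDegree := by exact_mod_cast hf
  obtain ⟨hxv, hyv⟩ := valuation_coord_and_gen hx hB hf hfp
  obtain ⟨a, b, hb, hbp, hab⟩ := hfp.exists_mul_add_mul_eq_neg_one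
  obtain ⟨b, rfl⟩ := Nat.exists_eq_succ_of_ne_zero hb.ne'
  have hr := valuation_derivation_algebraMap_le δ hδ hx (RatFunc.X ^ a)
  have hav : Q.valuation (algebraMap (RatFunc k) L (RatFunc.X ^ a)) = WithZero.exp (a * p) := by
    rw [map_zpow₀, map_zpow₀, hxv, WithZero.exp_zpow_eq]
  have hbv : Q.valuation ((b + 1 : ℕ) : L) = 1 := by
    have hbL : (((b + 1 : ℕ) : ℤ) : L) ≠ 0 := by
      rw [Int.cast_natCast, Ne, CharP.cast_eq_zero_iff L p]
      exact fun h => hbp.not_ge (Nat.le_of_dvd hb h)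
    have := Q.valuation_intCast_of_ne_zero hbL
    rwa [Int.cast_natCast] at this
  push_cast at hab
  rw [hav, hxv, ← WithZero.exp_neg, ← WithZero.exp_add] at hr
  refine ⟨algebraMap (RatFunc k) L (RatFunc.X ^ a) * B.gen ^ (b + 1), ?_, ?_⟩
  · rw [map_mul, map_pow, hav, hyv, WithZero.exp_pow_eq, ← WithZero.exp_add, ← WithZero.exp_zero,
      WithZero.exp_le_exp]
    push_cast
    rw [hab]
    norm_num
  · have h1 : Q.valuation (algebraMap (RatFunc k) L (RatFunc.X ^ a) *
        ((b + 1 : ℕ) * B.gen ^ b * δ B.gen)) =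
        WithZero.exp (p * f.natDegree - f.natDegree - p - 1 : ℤ) := by
      rw [map_mul, map_mul, map_mul, map_pow, hav, hbv, hyv,
        valuation_derivation_gen δ hδ hB hx hf hfp, WithZero.exp_pow_eq, one_mul,
        ← WithZero.exp_add, ← WithZero.exp_add]
      congr 1
      linear_combination hab
    -- Differentiating the power of `x` contributes an exponent of at most `-1 - p`, strictly below
    -- the main one.
    rw [Derivation.leibniz_mul_pow_succ, Q.valuation.map_add_eq_of_lt_left, h1]
    rw [h1, map_mul, map_pow, hyv, WithZero.exp_pow_eq]
    refine lt_of_le_of_lt (mul_le_mul_left hr _) ?_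
    rw [← WithZero.exp_add, WithZero.exp_lt_exp]
    push_cast
    nlinarith

end Infinity

end Place

/-! ### Counting lattice points. -/

/-- The interior lattice points of the triangle with vertices `(0, 0)`, `(s, 0)` and `(0, p)`. -/
def trianglePoints (s p : ℕ) : Finset (ℕ × ℕ) :=
  (Finset.Ioo 0 s ×ˢ Finset.Ioo 0 p).filter fun m => p * m.1 + s * m.2 < p * s

/-- The half turn `(i, j) ↦ (s - i, p - j)` of the rectangle exchanges the two sides of the
diagonal, which by coprimality contains no interior lattice point. -/
lemma two_mul_card_trianglePoints {s p : ℕ} (h : Nat.Coprime s p) :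
    2 * (trianglePoints s p).card = (s - 1) * (p - 1) := by
  have h1 := Finset.card_filter_add_card_filter_not (s := Finset.Ioo 0 s ×ˢ Finset.Ioo 0 p)
    (fun m : ℕ × ℕ => p * m.1 + s * m.2 < p * s)
  have h2 : (trianglePoints s p).card = ((Finset.Ioo 0 s ×ˢ Finset.Ioo 0 p).filter
      fun m : ℕ × ℕ => ¬ p * m.1 + s * m.2 < p * s).card := by
    refine Finset.card_bij' (fun m _ => (s - m.1, p - m.2)) (fun m _ => (s - m.1, p - m.2))
      ?_ ?_ ?_ ?_
    · rintro ⟨i, j⟩ hm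
      simp only [trianglePoints, Finset.mem_filter, Finset.mem_product, Finset.mem_Ioo] at hm ⊢
      obtain ⟨⟨⟨hi, hi'⟩, hj, hj'⟩, hlt⟩ := hm
      refine ⟨⟨⟨by omega, by omega⟩, by omega, by omega⟩, ?_⟩
      zify [hi'.le, hj'.le] at hlt ⊢
      nlinarith
    · rintro ⟨i, j⟩ hm
      simp only [trianglePoints, Finset.mem_filter, Finset.mem_product, Finset.mem_Ioo] at hm ⊢
      obtain ⟨⟨⟨hi, hi'⟩, hj, hj'⟩, hlt⟩ := hm
      have hne : p * i + s * j ≠ p * s := by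
        intro he
        have hd : p ∣ s * j := (Nat.dvd_add_right (Dvd.intro i rfl)).mp (he ▸ Dvd.intro s rfl)
        exact hj'.not_ge (Nat.le_of_dvd hj (h.symm.dvd_of_dvd_mul_left hd))
      refine ⟨⟨⟨by omega, by omega⟩, by omega, by omega⟩, ?_⟩
      have hgt : p * s < p * i + s * j := by omega
      zify [hi'.le, hj'.le] at hgt ⊢
      nlinarith
    · rintro ⟨i, j⟩ hm
      simp only [trianglePoints, Finset.mem_filter, Finset.mem_product, Finset.mem_Ioo] at hm
      ext <;> simp only <;> omega
    · rintro ⟨i, j⟩ hm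
      simp only [Finset.mem_filter, Finset.mem_product, Finset.mem_Ioo] at hm
      ext <;> simp only <;> omega
  rw [← h2, Finset.card_product, Nat.card_Ioo, Nat.card_Ioo, Nat.sub_zero, Nat.sub_zero] at h1
  rw [two_mul]
  exact h1

/-! ### A basis of the regular differentials. -/

section Genus

variable {k L : Type u} [Field k] [Field L] [Algebra k L] [Algebra (RatFunc k) L]
  [IsScalarTower k (RatFunc k) L] {p : ℕ} {f : k[X]} {B : PowerBasis (RatFunc k) L}
  (hB : IsArtinSchreier p (algebraMap k[X] (RatFunc k) f) B)

variable (B) in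
/-- The monomials `x ^ (i - 1) * y ^ (j - 1)` with `(i, j)` in the interior of the triangle. -/
noncomputable def monomialFamily (s p : ℕ) (m : trianglePoints s p) : L :=
  Place.coord k L ^ (m.1.1 - 1) * B.gen ^ (m.1.2 - 1)

include hB

/-- Powers of `x` are independent over `k`, and the powers of `y` below `p` are independent over
`k(x)`. -/
lemma linearIndependent_monomialFamily (s : ℕ) :
    LinearIndependent k (monomialFamily B s p) := by
  have h1 : LinearIndependent k (fun i : ℕ => (RatFunc.X : RatFunc k) ^ i) := by
    have h := (basisMonomials k).linearIndependent.map' (IsScalarTower.toAlgHom k k[X] (RatFunc k)).toLinearMap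
      (LinearMap.ker_eq_bot.mpr (IsFractionRing.injective k[X] (RatFunc k)))
    convert! h using 1
    ext i
    rw [Function.comp_apply, coe_basisMonomials, AlgHom.toLinearMap_apply]
    beta_reduce
    rw [← X_pow_eq_monomial, IsScalarTower.coe_toAlgHom', map_pow, RatFunc.algebraMap_X]
  have h2 := linearIndependent_smul h1 B.basis.linearIndependent
  let g : trianglePoints s p → ℕ × Fin B.dim := fun m => (m.1.1 - 1, ⟨m.1.2 - 1, by
    have := m.2
    simp only [trianglePoints, Finset.mem_filter, Finset.mem_product, Finset.mem_Ioo] at this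
    rw [hB.dim]
    omega⟩)
  have hg : Function.Injective g := by
    rintro ⟨⟨i, j⟩, hm⟩ ⟨⟨i', j'⟩, hm'⟩ h
    simp only [trianglePoints, Finset.mem_filter, Finset.mem_product, Finset.mem_Ioo] at hm hm'
    simp only [g, Prod.mk.injEq, Fin.mk.injEq] at h
    simp only [Subtype.mk.injEq, Prod.mk.injEq]
    omega
  have h3 := h2.comp g hg
  convert! h3 using 1
  ext m
  simp [g, monomialFamily, Algebra.smul_def]

variable [Fact p.Prime] [CharP k p] [IsAlgClosed k] [Algebra k[X] L]
  [IsScalarTower k[X] (RatFunc k) L]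
  (hf : 0 < f.natDegree) (hfp : Nat.Coprime f.natDegree p)
include hf hfp

lemma mem_regularDifferentials_iff {e : Ω[L⁄k] ≃ₗ[L] L} (he : e (D k L (Place.coord k L)) = 1)
    (ω : Ω[L⁄k]) : ω ∈ regularDifferentials k L ↔
      e ω ∈ Submodule.span k (Set.range (monomialFamily B f.natDegree p)) := by
  have : CharP (RatFunc k) p := charP_of_injective_algebraMap (algebraMap k _).injective p
  have := hB.isGalois
  have : FiniteDimensional (RatFunc k) L := B.finite
  let δ : Derivation k L L := e.toLinearMap.compDer (D k L)
  have hδ : δ (Place.coord k L) = 1 := he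
  constructor
  · intro hω
    obtain ⟨Q, hQ⟩ := Place.exists_one_lt_coord k L
    have hinf : Q.valuation (e ω) ≤
        WithZero.exp (p * f.natDegree - f.natDegree - p - 1 : ℤ) :=
      Place.IsRegularAt.valuation_le e (hω Q) fun t ht =>
        Place.valuation_derivation_le δ hδ hB hQ hf hfp ht
    -- At affine points `d/dx` preserves the local ring, so `ω / dx` has no affine pole.
    have hint : IsIntegral k[X] (e ω) := by
      refine Place.isIntegral_of_forall_le_one fun P hP => ?_
      obtain ⟨a, ha⟩ := Place.exists_isLocalModel hP hB
      exact Place.IsRegularAt.valuation_le e (hω P) fun t ht =>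
        ha.derivation_le_one δ (fun _ => Place.derivation_mem_adjoin δ hδ hB) ht
    obtain ⟨r, hr⟩ := hB.exists_repr_of_isIntegral rfl hint
    have hr' : e ω = ∑ j ∈ Finset.range p,
        algebraMap (RatFunc k) L (algebraMap k[X] (RatFunc k) (r j)) * B.gen ^ j := by
      simpa only [← IsScalarTower.algebraMap_apply] using hr
    rw [hr'] at hinf ⊢
    refine Submodule.sum_mem _ fun j hj => ?_
    have hle := (Place.valuation_term_le_sum hQ hB hf hfp
      (fun j => algebraMap k[X] (RatFunc k) (r j)) hj).trans hinf
    rw [Place.algebraMap_polynomial, aeval_eq_sum_range, Finset.sum_mul]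
    refine Submodule.sum_mem _ fun i hi => ?_
    by_cases hrj : r j = 0
    · simp [hrj]
    rw [Place.valuation_term_eq_exp hQ hB hf hfp (by simpa using hrj), WithZero.exp_le_exp,
      RatFunc.intDegree_polynomial] at hle
    rw [smul_mul_assoc]
    refine Submodule.smul_mem _ _ (Submodule.subset_span ?_)
    have hp : 0 < p := (Fact.out : p.Prime).pos
    have hi' : i ≤ (r j).natDegree := by
      rw [Finset.mem_range] at hi
      omega
    -- The terms `-s - p` in the order bound shift `(i, j)` to `(i + 1, j + 1)`, and the `-1` makes
    -- the inequality strict.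
    have hlt : p * (i + 1) + f.natDegree * (j + 1) < p * f.natDegree := by
      have : p * i ≤ p * (r j).natDegree := Nat.mul_le_mul_left p hi'
      zify at this ⊢
      linarith
    have hmem : (i + 1, j + 1) ∈ trianglePoints f.natDegree p := by
      simp only [trianglePoints, Finset.mem_filter, Finset.mem_product, Finset.mem_Ioo]
      refine ⟨⟨⟨by omega, ?_⟩, by omega, ?_⟩, hlt⟩
      · exact lt_of_mul_lt_mul_left (a := p) (by omega) hp.le
      · refine lt_of_mul_lt_mul_left (a := f.natDegree) ?_ hf.le
        rw [mul_comm f.natDegree p]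
        omega
    exact ⟨⟨_, hmem⟩, rfl⟩
  · intro h Q
    rcases le_or_gt (Q.valuation (Place.coord k L)) 1 with hQ | hQ
    -- At affine points `dx` itself serves as the comparison differential; at infinity it is `dt`
    -- for a function attaining the bound.
    · refine Place.isRegularAt_of_valuation_le e hQ (by rw [he]; exact one_ne_zero) ?_
      rw [he, map_one]
      generalize e ω = z at h ⊢
      induction h using Submodule.span_induction with
      | mem z hz =>
        obtain ⟨m, rfl⟩ := hz
        rw [monomialFamily, map_mul, map_pow, map_pow]
        exact mul_le_one' (pow_le_one' hQ _) (pow_le_one' (Place.valuation_gen_le_one hQ hB) _)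
      | zero => simp
      | add a b _ _ ha hb => exact Q.valuation.map_add_le ha hb
      | smul c a _ ha =>
        rw [Algebra.smul_def, map_mul]
        exact mul_le_one' (Q.valuation_le_one_algebraMap c) ha
    · obtain ⟨t, ht, hv⟩ := Place.exists_valuation_derivation_eq δ hδ hB hQ hf hfp
      obtain ⟨hxv, hyv⟩ := Place.valuation_coord_and_gen hQ hB hf hfp
      have hv' : Q.valuation (e (D k L t)) =
        WithZero.exp (p * f.natDegree - f.natDegree - p - 1 : ℤ) := hv
      refine Place.isRegularAt_of_valuation_le e ht ?_ ?_
      · intro h0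
        rw [h0, map_zero] at hv'
        exact WithZero.exp_ne_zero hv'.symm
      rw [hv']
      generalize e ω = z at h ⊢
      induction h using Submodule.span_induction with
      | mem z hz =>
        obtain ⟨⟨⟨i, j⟩, hm⟩, rfl⟩ := hz
        simp only [trianglePoints, Finset.mem_filter, Finset.mem_product, Finset.mem_Ioo] at hm
        obtain ⟨⟨⟨hi, -⟩, hj, -⟩, hlt⟩ := hm
        rw [monomialFamily, map_mul, map_pow, map_pow, hxv, hyv, WithZero.exp_pow_eq,
          WithZero.exp_pow_eq, ← WithZero.exp_add, WithZero.exp_le_exp, Nat.cast_sub hi,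
          Nat.cast_sub hj]
        zify at hlt
        push_cast
        linarith
      | zero => simp
      | add a b _ _ ha hb => exact Q.valuation.map_add_le ha hb
      | smul c a _ ha =>
        rw [Algebra.smul_def, map_mul]
        exact mul_le_of_le_one_of_le (Q.valuation_le_one_algebraMap c) ha

theorem curveGenus_eq_card_trianglePoints [IsScalarTower k k[X] L] :
    curveGenus k L = (trianglePoints f.natDegree p).card := by
  have : CharP (RatFunc k) p := charP_of_injective_algebraMap (algebraMap k _).injective p
  have := hB.isGalois
  obtain ⟨e, he⟩ := KaehlerDifferential.exists_equiv_of_isSeparable k L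
  have hmap : (regularDifferentials k L).map (e.restrictScalars k).toLinearMap =
      Submodule.span k (Set.range (monomialFamily B f.natDegree p)) := by
    ext z
    rw [Submodule.mem_map]
    constructor
    · rintro ⟨ω, hω, rfl⟩
      exact (mem_regularDifferentials_iff hB hf hfp he ω).mp hω
    · intro hz
      refine ⟨e.symm z, (mem_regularDifferentials_iff hB hf hfp he _).mpr ?_, ?_⟩
      · rwa [e.apply_symm_apply]
      · exact e.apply_symm_apply z
  rw [curveGenus, ((e.restrictScalars k).submoduleMap (regularDifferentials k L)).rank_eq]
  rw [show Submodule.map ((e.restrictScalars k : Ω[L⁄k] ≃ₗ[k] L) : Ω[L⁄k] →ₗ[k] L)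
    (regularDifferentials k L) = _ from hmap,
    rank_eq_card_basis (Module.Basis.span (linearIndependent_monomialFamily hB f.natDegree)),
    Fintype.card_coe]

end Genus

/-! ### Assembly of the main theorem. -/

theorem mainTheorem7 {k : Type*} [Field k] [IsAlgClosed k] (p : ℕ) [Fact p.Prime] [CharP k p]
    (f : k[X]) (s : ℕ) (hs : 0 < s) (hsp : Nat.Coprime s p) (hf : f.natDegree = s) :
    ∃ _ : Fact (Irreducible (artinSchreierPoly p f)),
      -- Galois with group cyclic of order `p`
      IsGalois (RatFunc k) (ArtinSchreierExt p f) ∧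
      Nonempty ((ArtinSchreierExt p f ≃ₐ[RatFunc k] ArtinSchreierExt p f) ≃*
        Multiplicative (ZMod p)) ∧
      -- ramified exactly at the unique point `Pinf` over infinity, with the stated
      -- ramification groups there
      (∃ Pinf : Place k (ArtinSchreierExt p f),
        (∀ Q : Place k (ArtinSchreierExt p f),
          Q.LiesOver (Place.infinity k) ↔ Q = Pinf) ∧
        Pinf.IsRamified (RatFunc k) ∧
        (∀ Q : Place k (ArtinSchreierExt p f), Q ≠ Pinf → Q.IsUnramified (RatFunc k)) ∧
        (∀ i : ℤ, -1 ≤ i → i ≤ s → Pinf.ramificationGroup (RatFunc k) i = Set.univ) ∧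
        (∀ i : ℤ, s < i → Pinf.ramificationGroup (RatFunc k) i = {1})) ∧
      -- the genus
      ∃ g : ℕ, curveGenus k (ArtinSchreierExt p f) = g ∧
        (g : ℚ) = ((p : ℚ) - 1) * ((s : ℚ) - 1) / 2 := by
  subst hf
  have hp : p.Prime := Fact.out
  have hf0 : f ≠ 0 := by rintro rfl; simp at hs
  have : CharP (RatFunc k) p := charP_of_injective_algebraMap (algebraMap k _).injective p
  have hirr : Irreducible (artinSchreierPoly p f) := by
    -- A root `b` in `k(x)` would have a pole at infinity with `p * deg b = deg f`, against
    -- coprimality.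
    refine irreducible_X_pow_sub_X_sub_C p _ fun b hb => ?_
    have hval : (Place.infinity k).valuation (algebraMap k[X] (RatFunc k) f) =
        WithZero.exp (f.natDegree : ℤ) := by
      rw [Place.infinity_valuation_of_ne_zero (by simpa using hf0), RatFunc.intDegree_polynomial]
    have h1 := (Place.infinity k).valuation.map_pow_sub_self_of_one_lt hp.one_lt (y := b) (by
      rw [hb, hval, ← WithZero.exp_zero, WithZero.exp_lt_exp]
      exact_mod_cast hs)
    have hb0 : b ≠ 0 := by
      rintro rfl
      rw [hb, hval, map_zero, zero_pow hp.ne_zero] at h1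
      exact WithZero.exp_ne_zero h1
    rw [hb, hval, Place.infinity_valuation_of_ne_zero hb0, WithZero.exp_pow_eq,
      WithZero.exp_inj] at h1
    have hd : (p : ℤ) ∣ f.natDegree := ⟨_, h1⟩
    exact (Nat.Prime.coprime_iff_not_dvd hp).mp hsp.symm (Int.natCast_dvd_natCast.mp hd)
  have hfact : Fact (Irreducible (artinSchreierPoly p f)) := ⟨hirr⟩
  have hmon : (artinSchreierPoly p f).Monic := monic_X_pow_sub_X_sub_C p _
  let B := AdjoinRoot.powerBasis' hmon
  have hB : IsArtinSchreier p (algebraMap k[X] (RatFunc k) f) B := by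
    refine ⟨natDegree_X_pow_sub_X_sub_C p _, ?_⟩
    have h : AdjoinRoot.mk (artinSchreierPoly p f)
        (X ^ p - X - C (algebraMap k[X] (RatFunc k) f)) = 0 := AdjoinRoot.mk_self
    rw [map_sub, map_sub, map_pow, AdjoinRoot.mk_X, AdjoinRoot.mk_C, sub_eq_zero] at h
    exact h
  have hgal := hB.isGalois
  have hfin : FiniteDimensional (RatFunc k) (ArtinSchreierExt p f) := B.finite
  obtain ⟨Q, hQ⟩ := Place.exists_one_lt_coord k (ArtinSchreierExt p f)
  refine ⟨hfact, hgal, hB.nonempty_mulEquiv, ⟨Q, fun P => ⟨fun h => ?_, ?_⟩,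
    Place.isRamified_of_one_lt hQ hB hs hsp, fun P hP => ?_,
    fun i _ hi => Place.ramificationGroup_eq_univ hQ hB hs hsp hi,
    fun i hi => Place.ramificationGroup_eq_one hQ hB hs hsp hi⟩,
    _, curveGenus_eq_card_trianglePoints hB hs hsp, ?_⟩
  · exact Place.eq_of_one_lt hQ hB hs hsp (Place.one_lt_of_liesOver_infinity h)
  · rintro rfl
    exact Place.liesOver_infinity hQ hB hs hsp
  · refine Place.isUnramified_of_le_one (not_lt.mp fun h => hP ?_) hB
    exact Place.eq_of_one_lt hQ hB hs hsp h
  · have h := two_mul_card_trianglePoints hsp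
    have h' := congrArg (Nat.cast : ℕ → ℚ) h
    rw [Nat.cast_mul, Nat.cast_mul, Nat.cast_sub hs, Nat.cast_sub hp.one_le] at h'
    push_cast at h'
    linarith
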